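/- Let $d,m\in\mathbb N$ and $1\le p_0<q_0\le\infty$. For $\xi\in\mathbb R^m$ let $\|\xi\|$ be the Euclidean norm and $|\xi|=(|\xi_1|,\dots,|\xi_m|)$; inequalities between vectors are meant componentwise. A cube is a closed cube $Q\subset\mathbb R^d$ of positive side length with sides parallel to the axes, $|Q|$ is its Lebesgue measure, and $\alpha Q$ is the cube with the same centre and $\alpha$ times the side length. $L^\infty_c(\mathbb R^d,\mathbb R^m)$ denotes the bounded measurable functions with compact support. Let $T$ be a bounded sublinear operator on $L^{p_0}(\mathbb R^d,\mathbb R^m)$: there is $B$ with $\|Tf\|_{p_0}\le B\|f\|_{p_0}$ for all $f$, and $\|T(f+g)\|\le\|Tf\|+\|Tg\|$ almost everywhere for all $f,g\in L^{p_0}(\mathbb R^d,\mathbb R^m)$ (homogeneity is not needed). Let $p\in(p_0,q_0)$, and let $S$ be a bounded linear operator on $L^p(\mathbb R^d,\mathbb R^m)$ such that $S(|g|)\le S(|h|)$ whenever $|g|\le|h|$ (almost everywhere). Assume that there exist constants $\alpha_2>\alpha_1>1$ and $C>0$ such that $$\Big(\frac1{|Q|}\int_Q\|Tf\|^{q_0}\,dx\Big)^{1/q_0}\le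 C\Big\{\Big(\frac1{|\alpha_1Q|}\int_{\alpha_1Q}\|Tf\|^{p_0}\,dx\Big)^{1/p_0}+\|(S|f|)(\bar x)\|\Big\}$$ for every cube $Q$, every $f\in L^\infty_c(\mathbb R^d,\mathbb R^m)$ whose (compact) support is contained in $\mathbb R^d\setminus\alpha_2Q$, and almost every $\bar x\in Q$; for $q_0=\infty$ the left-hand side is $\operatorname{ess\,sup}_Q\|Tf\|$. Then there exists a constant $K>0$ such that $$\|Tf\|_p\le K\|f\|_p\qquad\text{for all } f\in L^\infty_c(\mathbb R^d,\mathbb R^m).$$ -/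

import Mathlib

open MeasureTheory
open scoped ENNReal NNReal

/-- The componentwise absolute value `|ξ| = (|ξ₁|, …, |ξₘ|)` of a vector `ξ ∈ ℝᵐ`. -/
noncomputable def vecAbs {m : ℕ} (v : EuclideanSpace ℝ (Fin m)) : EuclideanSpace ℝ (Fin m) :=
  WithLp.toLp 2 (fun i => |v i|)

theorem vecAbs_zero {m : ℕ} : vecAbs (0 : EuclideanSpace ℝ (Fin m)) = 0 := by
  ext i
  simp [vecAbs]

theorem lipschitzWith_vecAbs {m : ℕ} :
    LipschitzWith 1 (vecAbs : EuclideanSpace ℝ (Fin m) → EuclideanSpace ℝ (Fin m)) := by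
  refine LipschitzWith.of_dist_le_mul fun u v => ?_
  rw [NNReal.coe_one, one_mul, EuclideanSpace.dist_eq, EuclideanSpace.dist_eq]
  refine Real.sqrt_le_sqrt (Finset.sum_le_sum fun i _ => ?_)
  have h : dist (vecAbs u i) (vecAbs v i) ≤ dist (u i) (v i) := by
    simpa [vecAbs, Real.dist_eq] using abs_abs_sub_abs_le_abs_sub (u i) (v i)
  gcongr

/-- The space `L^p(ℝ^d, ℝ^m)` for the Lebesgue measure on `ℝ^d` and the Euclidean norm on `ℝ^m`. -/
abbrev LpVec (d m : ℕ) (p : ℝ≥0∞) : Type :=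
  Lp (EuclideanSpace ℝ (Fin m)) p (volume : Measure (EuclideanSpace ℝ (Fin d)))

/-- The componentwise absolute value `|g|` of `g ∈ L^p(ℝ^d, ℝ^m)`. -/
noncomputable def lpAbs {d m : ℕ} {p : ℝ≥0∞} (g : LpVec d m p) : LpVec d m p :=
  lipschitzWith_vecAbs.compLp vecAbs_zero g

theorem coeFn_lpAbs {d m : ℕ} {p : ℝ≥0∞} (g : LpVec d m p) :
    ∀ᵐ x, lpAbs g x = vecAbs (g x) :=
  lipschitzWith_vecAbs.coeFn_compLp vecAbs_zero g

/-- `f ∈ L^∞_c(ℝ^d, ℝ^m)`: `f` is (essentially) bounded, measurable and compactly supported. -/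
structure IsLinftyC {d m : ℕ} (f : EuclideanSpace ℝ (Fin d) → EuclideanSpace ℝ (Fin m)) :
    Prop where
  memLp_top : MemLp f ∞ volume
  hasCompactSupport : HasCompactSupport f

theorem IsLinftyC.memLp {d m : ℕ} {f : EuclideanSpace ℝ (Fin d) → EuclideanSpace ℝ (Fin m)}
    (hf : IsLinftyC f) (p : ℝ≥0∞) : MemLp f p volume := by
  have hK : volume (tsupport f) ≠ ∞ := hf.hasCompactSupport.isCompact.measure_ne_top
  exact hf.memLp_top.mono_exponent_of_measure_support_ne_top
    (fun x hx => image_eq_zero_of_notMem_tsupport hx) hK le_top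

/-- The class in `L^p(ℝ^d, ℝ^m)` of a function in `L^∞_c(ℝ^d, ℝ^m)`. -/
noncomputable def IsLinftyC.toLpVec {d m : ℕ}
    {f : EuclideanSpace ℝ (Fin d) → EuclideanSpace ℝ (Fin m)} (hf : IsLinftyC f) (p : ℝ≥0∞) :
    LpVec d m p :=
  (hf.memLp p).toLp f

/-- The closed cube in `ℝ^d` with centre `c`, side length `2 r` and sides parallel to the axes. If
`Q = cube c r`, then the dilated cube `α Q` (same centre) is `cube c (α * r)`. -/
def cube {d : ℕ} (c : EuclideanSpace ℝ (Fin d)) (r : ℝ) : Set (EuclideanSpace ℝ (Fin d)) :=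
  {x | ∀ i, |x i - c i| ≤ r}

/-- The average `(|Q|⁻¹ ∫_Q ‖g‖^q dx)^{1/q}` for `q < ∞`, and `ess sup_Q ‖g‖` for `q = ∞`, as an
extended nonnegative real: the `L^q` norm of `g` for the normalized Lebesgue measure on `Q`. -/
noncomputable def lpAverage {d m : ℕ} (q : ℝ≥0∞) (Q : Set (EuclideanSpace ℝ (Fin d)))
    (g : EuclideanSpace ℝ (Fin d) → EuclideanSpace ℝ (Fin m)) : ℝ≥0∞ :=
  eLpNorm g q ((volume Q)⁻¹ • volume.restrict Q)

/-- The operator `T` on `L^p(ℝ^d, ℝ^m)`, not necessarily linear, is bounded. -/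
def IsBoundedOnLp {d m : ℕ} {p : ℝ≥0∞} (T : LpVec d m p → LpVec d m p) : Prop :=
  ∃ B : ℝ, ∀ f, ‖T f‖ ≤ B * ‖f‖

/-- Sublinearity of `T` in the sense `‖T(f + g)‖ ≤ ‖T f‖ + ‖T g‖` almost everywhere. Homogeneity
is not required, so this covers also the notion of sublinearity that includes it. -/
def IsSublinearOnLp {d m : ℕ} {p : ℝ≥0∞} (T : LpVec d m p → LpVec d m p) : Prop :=
  ∀ f g : LpVec d m p, ∀ᵐ x, ‖T (f + g) x‖ ≤ ‖T f x‖ + ‖T g x‖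

/-- `S(|g|) ≤ S(|h|)` componentwise whenever `|g| ≤ |h|` componentwise (almost everywhere). -/
def IsAbsMonotone {d m : ℕ} {p : ℝ≥0∞} (S : LpVec d m p → LpVec d m p) : Prop :=
  ∀ g h : LpVec d m p, (∀ᵐ x, ∀ i, |g x i| ≤ |h x i|) →
    ∀ᵐ x, ∀ i, S (lpAbs g) x i ≤ S (lpAbs h) x i

/-!
Put `a = p₀`, `U = ‖T f‖ ^ a`, `v = ‖f‖ ^ a`, `σ = ‖S |f|‖ ^ a`. The claim is an `L ^ (p / p₀)`
bound for `U` in terms of `v` and `σ`, and it follows from a good-λ argument on stopping balls.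

*Local decompositions.* On a ball `B`, split `f` into its restriction `g` to a large concentric
cube and the rest `h`. Then `U` is at most a constant times `‖T g‖ ^ a + ‖T h‖ ^ a`. The first
term has integral controlled by `v` near `B`. For the second term the hypothesis on `T` bounds the
average of `‖T h‖ ^ q` over `B`. Indeed `‖T h‖ ≤ ‖T f‖ + ‖T (-g)‖`, so the average of `‖T h‖ ^ a`
is controlled by `U + v` near `B`, while `‖S |h|‖ ≤ ‖S |f|‖` by monotonicity of `S`. This is
`exists_hasLocalDecomposition`; an infinite `q₀` is first replaced by a finite exponent `q`
between `p` and `q₀`.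

*Level sets.* Fix a level `τ`. Almost every point of `{U > τ}` is the centre of a ball on which
the average of `U + K v` exceeds `τ`, whereas on all concentric balls of at least twice its radius
the average is at most `τ` (`ae_exists_stopping_radius`). Vitali's lemma gives disjoint balls `B`
of this kind whose dilates `5 B` cover `{U > τ}` up to a null set. If `σ` is large on all of
`5 B`, then `B` is part of `{σ > τ}`. Otherwise the decomposition on `5 B` shows that the part of
`U` above `Λ τ` has integral at most `ε τ |B|` there, with `ε` small when `Λ` and `K` are large.
Since `τ |B|` is at most twice the integral over `B` of `U` on `{U > τ / 4}` plus that of `K v` on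
`{v > τ / (4 K)}`, summation gives an inequality between level sets (`withDensity_setOf_lt_le`).

*Integration.* Integrate this inequality against `τ ^ (s - 1)`, where `s = p / p₀ - 1`. The term
with `U` on the right carries the factor `ε Λ ^ s`, up to a constant, which can be made small
because `p < q` (`exists_decompositionConst_mul_le`), so this term can be absorbed. Truncating `U`
makes the absorbed integral finite, as `U` is integrable; the truncation is then removed
(`exists_lintegral_rpow_le`). No maximal function is needed. Dimension zero, where there are no
stopping balls, is trivial, since all `L ^ p` norms of a function coincide.
-/

open Filter Metric Set Module
open scoped Topology

/-! ### Stopping balls and Vitali's covering lemma -/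

section Covering

variable {E : Type*} [NormedAddCommGroup E] [NormedSpace ℝ E] [FiniteDimensional ℝ E]
  [MeasurableSpace E] [BorelSpace E] {μ : Measure E}

/-- A consequence of Vitali's covering lemma: if almost every point of `S` is the centre of a ball
`B` of bounded radius for which the part of `S` in `5 B` has `ν`-measure at most `M B`, then `ν S`
is at most the total mass of `M`. -/
theorem measure_le_of_forall_closedBall {ν M : Measure E} (hν : ν ≪ μ) {S : Set E} {R : ℝ}
    (h : ∀ᵐ x ∂μ, x ∈ S → ∃ r, 0 < r ∧ r ≤ R ∧
      ν (closedBall x (5 * r) ∩ S) ≤ M (closedBall x r)) :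
    ν S ≤ M univ := by
  set t : Set E := {x | ∃ r, 0 < r ∧ r ≤ R ∧
    ν (closedBall x (5 * r) ∩ S) ≤ M (closedBall x r)} with ht
  have hch : ∀ x : E, ∃ r : ℝ, x ∈ t → 0 < r ∧ r ≤ R ∧
      ν (closedBall x (5 * r) ∩ S) ≤ M (closedBall x r) := by
    intro x
    by_cases hx : x ∈ t
    · obtain ⟨r, hr⟩ := hx
      exact ⟨r, fun _ => hr⟩
    · exact ⟨0, fun hx' => absurd hx' hx⟩
  choose r hr using hch
  obtain ⟨u, hut, hdisj, hcov⟩ := Vitali.exists_disjoint_subfamily_covering_enlargement_closedBall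
    t id r R (fun a ha => (hr a ha).2.1) 5 (by norm_num)
  have hcount : u.Countable := hdisj.countable_of_nonempty_interior fun i hi =>
    ⟨i, ball_subset_interior_closedBall (mem_ball_self (hr i (hut hi)).1)⟩
  have hsub : S ⊆ (⋃ b ∈ u, closedBall b (5 * r b) ∩ S) ∪ {x | ¬ (x ∈ S → x ∈ t)} := by
    intro x hxS
    by_cases hx : x ∈ t
    · left
      obtain ⟨b, hb, hsb⟩ := hcov x hx
      exact mem_biUnion hb ⟨hsb (mem_closedBall_self (hr x hx).1.le), hxS⟩
    · right
      exact fun h => hx (h hxS)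
  have hnull : ν {x | ¬ (x ∈ S → x ∈ t)} = 0 := hν (ae_iff.1 h)
  calc ν S ≤ ν (⋃ b ∈ u, closedBall b (5 * r b) ∩ S) + ν {x | ¬ (x ∈ S → x ∈ t)} :=
        (measure_mono hsub).trans (measure_union_le _ _)
    _ = ν (⋃ b ∈ u, closedBall b (5 * r b) ∩ S) := by rw [hnull, add_zero]
    _ ≤ ∑' b : u, ν (closedBall (b : E) (5 * r b) ∩ S) := measure_biUnion_le _ hcount _
    _ ≤ ∑' b : u, M (closedBall (b : E) (r b)) :=
        ENNReal.tsum_le_tsum fun b => (hr b (hut b.2)).2.2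
    _ = M (⋃ b ∈ u, closedBall b (r b)) :=
        (measure_biUnion hcount hdisj fun b _ => measurableSet_closedBall).symm
    _ ≤ M univ := measure_mono (subset_univ _)

variable [μ.IsAddHaarMeasure]

theorem measure_closedBall_mul (x : E) {c r : ℝ} (hc : 0 ≤ c) (hr : 0 ≤ r) :
    μ (closedBall x (c * r)) = ENNReal.ofReal c ^ finrank ℝ E * μ (closedBall x r) := by
  rw [Measure.addHaar_closedBall_mul μ x hc hr, ENNReal.ofReal_pow hc,
    Measure.addHaar_closedBall_center μ x r]

theorem exists_le_mul_measure_closedBall [Nontrivial E] {M τ : ℝ≥0∞} (hM : M ≠ ∞) (hτ : τ ≠ 0)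
    (hτ' : τ ≠ ∞) :
    ∃ R : ℝ, M ≤ τ * μ (closedBall 0 R) := by
  have h1 : Tendsto (fun k : ℕ => μ (closedBall (0 : E) k)) atTop (𝓝 ∞) := by
    have h := tendsto_measure_iUnion_atTop (μ := μ) (s := fun k : ℕ => closedBall (0 : E) k)
      (fun i j hij => closedBall_subset_closedBall (by exact_mod_cast hij))
    have hu : (⋃ k : ℕ, closedBall (0 : E) k) = univ := iUnion_closedBall_nat 0
    have : NoncompactSpace E := NormedSpace.noncompactSpace ℝ E
    rwa [hu, measure_univ_of_isAddLeftInvariant] at h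
  have hlt : M / τ < ∞ := ENNReal.div_lt_top hM hτ
  obtain ⟨k, hk⟩ := (h1.eventually (lt_mem_nhds hlt)).exists
  refine ⟨k, ?_⟩
  rw [mul_comm]
  exact ENNReal.div_le_iff_le_mul (Or.inl hτ) (Or.inl hτ') |>.1 hk.le

/-- The stopping-time argument: almost every point where the integrable function `w` exceeds `τ` is
the centre of a ball over which the average of `w` exceeds `τ`, while all concentric balls of at
least twice the radius have average at most `τ`. The radii are bounded, since in positive dimension
the averages over large balls are small. -/
theorem ae_exists_stopping_radius [Nontrivial E] {w : E → ℝ≥0∞} (hw : Measurable w)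
    (hwi : ∫⁻ x, w x ∂μ ≠ ∞) {τ : ℝ≥0∞} (hτ : τ ≠ 0) (hτ' : τ ≠ ∞) :
    ∃ R : ℝ, ∀ᵐ x ∂μ, τ < w x → ∃ r, 0 < r ∧ r ≤ R ∧
      τ * μ (closedBall x r) < ∫⁻ y in closedBall x r, w y ∂μ ∧
      ∀ r', 2 * r ≤ r' → ∫⁻ y in closedBall x r', w y ∂μ ≤ τ * μ (closedBall x r') := by
  obtain ⟨R, hR⟩ := exists_le_mul_measure_closedBall (μ := μ) hwi hτ hτ'
  refine ⟨R, ?_⟩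
  filter_upwards [(Besicovitch.vitaliFamily μ).ae_tendsto_lintegral_div' hw hwi] with x hx hτx
  set S : Set ℝ := {r | 0 < r ∧ τ * μ (closedBall x r) < ∫⁻ y in closedBall x r, w y ∂μ} with hS
  have hSR : ∀ r ∈ S, r ≤ R := by
    rintro r ⟨_, h⟩
    by_contra! hlt
    have h1 : τ * μ (closedBall 0 R) ≤ τ * μ (closedBall x r) := by
      rw [← Measure.addHaar_closedBall_center μ x R]
      gcongr
    exact absurd h (not_lt.2 ((setLIntegral_le_lintegral _ _).trans (hR.trans h1)))
  have hne : S.Nonempty := by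
    have h1 := (hx.comp (Besicovitch.tendsto_filterAt μ x)).eventually (lt_mem_nhds hτx)
    obtain ⟨r, hr, hr0⟩ := (h1.and self_mem_nhdsWithin).exists
    refine ⟨r, hr0, ?_⟩
    have hpos : μ (closedBall x r) ≠ 0 := (measure_closedBall_pos μ x hr0).ne'
    exact (ENNReal.lt_div_iff_mul_lt (Or.inl hpos) (Or.inl measure_closedBall_lt_top.ne)).1 hr
  have hbdd : BddAbove S := ⟨R, hSR⟩
  have hpos : 0 < sSup S := by
    obtain ⟨r, hr⟩ := hne
    exact hr.1.trans_le (le_csSup hbdd hr)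
  obtain ⟨r, hr, hlt⟩ := exists_lt_of_lt_csSup hne (half_lt_self hpos)
  refine ⟨r, hr.1, hSR r hr, hr.2, fun r' hr' => ?_⟩
  by_contra! h
  have h2 : r' ≤ sSup S := le_csSup hbdd ⟨by linarith [hr.1], h⟩
  linarith

end Covering

/-! ### Decompositions on balls and level sets -/

section Chebyshev

variable {α : Type*} [MeasurableSpace α] {μ : Measure α}

/-- The part of the integral over `B` where `f ≤ c` is at most `c * μ B`; the rest is written as a
measure with density `f`. -/
theorem setLIntegral_le_add_mul {f : α → ℝ≥0∞} (hf : Measurable f) (B : Set α) (c : ℝ≥0∞) :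
    ∫⁻ y in B, f y ∂μ ≤ μ.withDensity f (B ∩ {y | c < f y}) + c * μ B := by
  have hS : MeasurableSet {y | c < f y} := measurableSet_lt measurable_const hf
  calc ∫⁻ y in B, f y ∂μ ≤ ∫⁻ y in B, ({y | c < f y}.indicator f y + c) ∂μ := by
        refine lintegral_mono fun y => ?_
        by_cases hy : c < f y
        · rw [indicator_of_mem (show y ∈ {y | c < f y} from hy)]
          exact le_self_add
        · exact (not_lt.1 hy).trans le_add_self
    _ = ∫⁻ y in B, {y | c < f y}.indicator f y ∂μ + c * μ B := by
        rw [lintegral_add_right _ measurable_const, setLIntegral_const]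
    _ = ∫⁻ y in B ∩ {y | c < f y}, f y ∂μ + c * μ B := by
        rw [lintegral_indicator hS, Measure.restrict_restrict hS, inter_comm]
    _ ≤ _ := by
        gcongr
        exact withDensity_apply_le _ _

/-- On a ball where the average of `U + K v` exceeds `τ`, the mass `τ * μ B` is comparable to the
parts of the integrals of `U` and `K v` that come from the points where these functions are not
much smaller than `τ`. -/
theorem mul_measure_le_of_lt_setLIntegral {U v : α → ℝ≥0} (hU : Measurable U) (hv : Measurable v)
    {B : Set α} (hB : μ B ≠ ∞) {τ K : ℝ≥0} (hK : K ≠ 0)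
    (h : τ * μ B ≤ ∫⁻ y in B, (U y + K * v y : ℝ≥0∞) ∂μ) :
    τ * μ B ≤ 2 * (μ.withDensity (fun y => (U y : ℝ≥0∞)) (B ∩ {y | τ / 4 < U y}) +
      K * μ.withDensity (fun y => (v y : ℝ≥0∞)) (B ∩ {y | τ / (4 * K) < v y})) := by
  have h1 := setLIntegral_le_add_mul (μ := μ) hU.coe_nnreal_ennreal B ((τ / 4 : ℝ≥0) : ℝ≥0∞)
  have h2 := setLIntegral_le_add_mul (μ := μ) hv.coe_nnreal_ennreal B ((τ / (4 * K) : ℝ≥0) : ℝ≥0∞)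
  rw [lintegral_add_left hU.coe_nnreal_ennreal, lintegral_const_mul _ hv.coe_nnreal_ennreal] at h
  simp only [ENNReal.coe_lt_coe] at h1 h2
  set X := μ.withDensity (fun y => (U y : ℝ≥0∞)) (B ∩ {y | τ / 4 < U y})
  set Y := μ.withDensity (fun y => (v y : ℝ≥0∞)) (B ∩ {y | τ / (4 * K) < v y})
  lift μ B to ℝ≥0 using hB with m hm
  have hKK : (K : ℝ≥0∞) * ((τ / (4 * K) : ℝ≥0) * m) = ((τ / 4 * m : ℝ≥0) : ℝ≥0∞) := by
    norm_cast
    field_simp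
  have h3 : (τ : ℝ≥0∞) * m ≤ (X + K * Y) + ((τ / 2 * m : ℝ≥0) : ℝ≥0∞) := by
    calc (τ : ℝ≥0∞) * m ≤ (X + (τ / 4 : ℝ≥0) * m) + K * (Y + (τ / (4 * K) : ℝ≥0) * m) := by
          refine h.trans ?_
          gcongr
      _ = (X + K * Y) + ((τ / 4 * m : ℝ≥0) + (τ / 4 * m : ℝ≥0) : ℝ≥0∞) := by
          rw [mul_add, hKK]
          push_cast
          ring
      _ = _ := by
          congr 1
          norm_cast
          rw [← add_mul]
          congr 1
          rw [← NNReal.coe_inj]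
          push_cast
          ring
  generalize X + K * Y = Z at h3 ⊢
  induction Z with
  | top => simp
  | coe z =>
    norm_cast at h3 ⊢
    rw [← NNReal.coe_le_coe] at h3 ⊢
    push_cast at h3 ⊢
    linarith

/-- Above the level `2 s`, a sum `g + h` is controlled by `g` and the power `h ^ θ`: if `h` is the
larger summand, then `h > s` and `h ≤ s ^ (1 - θ) * h ^ θ`. -/
theorem le_two_mul_add_of_lt {u g h s : ℝ≥0∞} {θ : ℝ} (hθ : 1 ≤ θ) (hs : s ≠ 0) (hs' : s ≠ ∞)
    (hu : u ≤ g + h) (hsu : 2 * s < u) : u ≤ 2 * g + 2 * s ^ (1 - θ) * h ^ θ := by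
  rcases le_total h g with hgh | hgh
  · calc u ≤ g + g := hu.trans (by gcongr)
      _ = 2 * g := (two_mul g).symm
      _ ≤ _ := le_self_add
  · have h2 : u ≤ 2 * h := by
      rw [two_mul]
      exact hu.trans (by gcongr)
    have hsh : s < h := by
      by_contra! hle
      exact absurd hsu (not_lt.2 (h2.trans (by gcongr)))
    have h3 : h ≤ s ^ (1 - θ) * h ^ θ := by
      rcases eq_or_ne h ∞ with rfl | hh
      · rw [ENNReal.top_rpow_of_pos (by linarith), ENNReal.mul_top]
        exact (ENNReal.rpow_pos (pos_iff_ne_zero.2 hs) hs').ne'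
      · have hh0 : h ≠ 0 := (hsh.trans_le' zero_le).ne'
        calc h = h ^ (1 - θ) * h ^ θ := by
              rw [← ENNReal.rpow_add _ _ hh0 hh]
              simp
          _ ≤ s ^ (1 - θ) * h ^ θ := by
              gcongr ?_ * _
              rw [show 1 - θ = -(θ - 1) by ring, ENNReal.rpow_neg, ENNReal.rpow_neg]
              exact ENNReal.inv_le_inv.2 (ENNReal.rpow_le_rpow hsh.le (by linarith))
    calc u ≤ 2 * (s ^ (1 - θ) * h ^ θ) := h2.trans (by gcongr)
      _ ≤ _ := by
        rw [mul_assoc]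
        exact le_add_self

end Chebyshev

section StoppingBalls

variable {E : Type*} [NormedAddCommGroup E] [NormedSpace ℝ E] [FiniteDimensional ℝ E]
  [MeasurableSpace E] [BorelSpace E] {μ : Measure E} [μ.IsAddHaarMeasure]

/-- The hypothesis of the real-variable argument. For each ball `B` with centre `x` and radius `r`,
the function `U` is dominated by `G + H`, where `G` is controlled by `v` on the ball `N B` dilated
by `N`, and `H` has the reverse Hölder exponent `θ`: if `t` bounds the mass of `U + v` on `N B`
relative to the measure of `B`, and `σ ≤ t` on a non-null part of `B`, then the average of `H ^ θ`
over `B` is at most `C₂ t ^ θ`. -/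
def HasLocalDecomposition {E : Type*} [PseudoMetricSpace E] [MeasurableSpace E] (μ : Measure E)
    (N C₁ C₂ : ℝ≥0) (θ : ℝ) (U v σ : E → ℝ≥0) : Prop :=
  ∀ (x : E) (r : ℝ), 0 < r → ∃ G H : E → ℝ≥0∞, Measurable G ∧
    (∀ᵐ y ∂μ, (U y : ℝ≥0∞) ≤ G y + H y) ∧
    ∫⁻ y, G y ∂μ ≤ C₁ * ∫⁻ y in closedBall x (N * r), v y ∂μ ∧
    ∀ t : ℝ≥0, ∫⁻ y in closedBall x (N * r), (U y + v y : ℝ≥0∞) ∂μ ≤ t * μ (closedBall x r) →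
      (∃ᵐ y ∂(μ.restrict (closedBall x r)), σ y ≤ t) →
      ∫⁻ y in closedBall x r, H y ^ θ ∂μ ≤ C₂ * (t : ℝ≥0∞) ^ θ * μ (closedBall x r)

/-- The factor in the estimate on a stopping ball: the first summand comes from the integrable
part of the local decomposition, the second one from Chebyshev's inequality with exponent `θ`. -/
noncomputable def decompositionConst (N C₁ C₂ : ℝ≥0) (n : ℕ) (θ : ℝ) (K Λ : ℝ≥0) : ℝ≥0 :=
  2 * C₁ * N ^ n * 5 ^ n * K⁻¹ + 2 * C₂ * 5 ^ n * (N ^ n) ^ θ * (Λ / 2) ^ (1 - θ)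

/-- The estimate on a single stopping ball. If `σ` is small somewhere, the local decomposition
bounds the part of `U` above the level `Λ τ` by a multiple of `τ * μ B` whose factor is small for
large `Λ` and `K`; otherwise `B` lies in `{τ < σ}` up to a null set. -/
theorem withDensity_closedBall_inter_le {N C₁ C₂ : ℝ≥0} {θ : ℝ} {U v σ : E → ℝ≥0}
    (h : HasLocalDecomposition μ N C₁ C₂ θ U v σ) (hU : Measurable U)
    (hN : 1 ≤ N) (hθ : 1 ≤ θ) {τ K Λ : ℝ≥0} (hτ : τ ≠ 0) (hK : 1 ≤ K) (hΛ : Λ ≠ 0)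
    {x : E} {r : ℝ} (hr : 0 < r)
    (hdouble : ∀ r', 2 * r ≤ r' → ∫⁻ y in closedBall x r', (U y + K * v y : ℝ≥0∞) ∂μ ≤
      τ * μ (closedBall x r')) :
    μ.withDensity (fun y => (U y : ℝ≥0∞)) (closedBall x (5 * r) ∩ {y | Λ * τ < U y}) ≤
      (decompositionConst N C₁ C₂ (finrank ℝ E) θ K Λ : ℝ≥0∞) * (τ * μ (closedBall x r)) +
        5 ^ finrank ℝ E * τ * μ (closedBall x r ∩ {y | τ < σ y}) := by
  set n := finrank ℝ E with hn
  set m := μ (closedBall x r) with hm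
  have hS : MeasurableSet {y | Λ * τ < U y} := measurableSet_lt measurable_const hU
  have h5 : μ (closedBall x (5 * r)) = 5 ^ n * m := by
    rw [measure_closedBall_mul x (by norm_num) hr.le]
    norm_num [hn, hm]
  have hN5 : μ (closedBall x (N * (5 * r))) = N ^ n * (5 ^ n * m) := by
    rw [measure_closedBall_mul x N.coe_nonneg (by positivity), h5, ← hn]
    congr 2
    exact ENNReal.ofReal_coe_nnreal
  have hbig : ∫⁻ y in closedBall x (N * (5 * r)), (U y + K * v y : ℝ≥0∞) ∂μ ≤
      τ * (N ^ n * (5 ^ n * m)) := by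
    rw [← hN5]
    refine hdouble _ ?_
    have : (1 : ℝ) ≤ N := hN
    nlinarith
  rw [withDensity_apply _ (measurableSet_closedBall.inter hS)]
  -- Either `σ` is small on a non-null part of the dilated ball, or `σ > N ^ n * τ ≥ τ` almost
  -- everywhere on it.
  by_cases hσ : ∃ᵐ y ∂(μ.restrict (closedBall x (5 * r))), σ y ≤ N ^ n * τ
  · refine le_add_right ?_
    obtain ⟨G, H, hG, hUGH, hGv, hH⟩ := h x (5 * r) (by positivity)
    have hH' := hH (N ^ n * τ) ?_ hσ
    swap
    · calc ∫⁻ y in closedBall x (N * (5 * r)), (U y + v y : ℝ≥0∞) ∂μ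
          ≤ ∫⁻ y in closedBall x (N * (5 * r)), (U y + K * v y : ℝ≥0∞) ∂μ := by
            refine lintegral_mono fun y => ?_
            gcongr
            exact le_mul_of_one_le_left zero_le (ENNReal.one_le_coe_iff.2 hK)
        _ ≤ τ * (N ^ n * (5 ^ n * m)) := hbig
        _ = _ := by
            rw [h5]
            push_cast
            ring
    have hv : (K : ℝ≥0∞) * ∫⁻ y in closedBall x (N * (5 * r)), v y ∂μ ≤
        τ * (N ^ n * (5 ^ n * m)) := by
      rw [← lintegral_const_mul' _ _ ENNReal.coe_ne_top]
      exact (lintegral_mono fun y => le_add_self).trans hbig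
    have hK0 : K ≠ 0 := (one_pos.trans_le hK).ne'
    have hv' : ∫⁻ y in closedBall x (N * (5 * r)), v y ∂μ ≤
        ((K⁻¹ : ℝ≥0) : ℝ≥0∞) * (τ * (N ^ n * (5 ^ n * m))) := by
      rw [ENNReal.coe_inv hK0]
      rwa [← ENNReal.mul_le_iff_le_inv (by exact_mod_cast hK0) ENNReal.coe_ne_top]
    -- The level `Λ τ` is split evenly between the two parts of the decomposition.
    set s : ℝ≥0 := Λ / 2 * τ with hs
    have hs0 : s ≠ 0 := by positivity
    have h2s : 2 * s = Λ * τ := by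
      rw [hs]
      field_simp
    have hpow : s ^ (1 - θ) * (N ^ n * τ) ^ θ = (Λ / 2) ^ (1 - θ) * (N ^ n) ^ θ * τ := by
      rw [hs, NNReal.mul_rpow, NNReal.mul_rpow]
      have h1 : τ ^ (1 - θ) * τ ^ θ = τ := by
        rw [← NNReal.rpow_add hτ]
        simp
      calc _ = (Λ / 2) ^ (1 - θ) * (N ^ n) ^ θ * (τ ^ (1 - θ) * τ ^ θ) := by ring
        _ = _ := by rw [h1]
    calc ∫⁻ y in closedBall x (5 * r) ∩ {y | Λ * τ < U y}, (U y : ℝ≥0∞) ∂μ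
        ≤ ∫⁻ y in closedBall x (5 * r) ∩ {y | Λ * τ < U y},
            (2 * G y + 2 * (s : ℝ≥0∞) ^ (1 - θ) * H y ^ θ) ∂μ := by
          refine lintegral_mono_ae ?_
          filter_upwards [ae_restrict_of_ae hUGH,
            ae_restrict_mem (measurableSet_closedBall.inter hS)] with y hy hyS
          refine le_two_mul_add_of_lt hθ (by exact_mod_cast hs0) ENNReal.coe_ne_top hy ?_
          have := hyS.2
          rw [mem_ofPred_eq, ← h2s] at this
          exact_mod_cast this
      _ ≤ ∫⁻ y in closedBall x (5 * r), (2 * G y + 2 * (s : ℝ≥0∞) ^ (1 - θ) * H y ^ θ) ∂μ :=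
          lintegral_mono_set inter_subset_left
      _ = 2 * ∫⁻ y in closedBall x (5 * r), G y ∂μ +
            2 * (s : ℝ≥0∞) ^ (1 - θ) * ∫⁻ y in closedBall x (5 * r), H y ^ θ ∂μ := by
          rw [lintegral_add_left (hG.const_mul 2), lintegral_const_mul _ hG,
            lintegral_const_mul']
          rw [← ENNReal.coe_rpow_of_ne_zero hs0]
          finiteness
      _ ≤ 2 * (C₁ * (((K⁻¹ : ℝ≥0) : ℝ≥0∞) * (τ * (N ^ n * (5 ^ n * m))))) +
            2 * (s : ℝ≥0∞) ^ (1 - θ) *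
              (C₂ * ((N ^ n * τ : ℝ≥0) : ℝ≥0∞) ^ θ * (5 ^ n * m)) := by
          rw [h5] at hH'
          gcongr
          exact (setLIntegral_le_lintegral _ _).trans (hGv.trans (by gcongr))
      _ = ((2 * C₁ * K⁻¹ * N ^ n * 5 ^ n * τ + 2 * C₂ * 5 ^ n *
            (s ^ (1 - θ) * (N ^ n * τ) ^ θ) : ℝ≥0) : ℝ≥0∞) * m := by
          rw [← ENNReal.coe_rpow_of_ne_zero hs0, ← ENNReal.coe_rpow_of_nonneg _ (by linarith)]
          push_cast
          ring
      _ = _ := by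
          rw [hpow, decompositionConst]
          push_cast
          ring
  · refine le_add_left ?_
    have hσ' : ∀ᵐ y ∂(μ.restrict (closedBall x r)), τ < σ y := by
      have h1 : ∀ᵐ y ∂(μ.restrict (closedBall x (5 * r))), N ^ n * τ < σ y := by
        simpa [not_frequently, not_le] using hσ
      refine (ae_restrict_of_ae_restrict_of_subset
        (closedBall_subset_closedBall (by linarith)) h1).mono fun y hy => lt_of_le_of_lt ?_ hy
      exact le_mul_of_one_le_left zero_le (one_le_pow₀ hN)
    have hmeq : μ (closedBall x r ∩ {y | τ < σ y}) = m := by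
      refine (measure_mono inter_subset_left).antisymm ?_
      rw [← Measure.restrict_apply_self μ (closedBall x r), inter_comm,
        ← Measure.restrict_apply' measurableSet_closedBall]
      refine measure_mono_ae ?_
      filter_upwards [hσ'] with y hy _ using hy
    calc ∫⁻ y in closedBall x (5 * r) ∩ {y | Λ * τ < U y}, (U y : ℝ≥0∞) ∂μ
        ≤ ∫⁻ y in closedBall x (5 * r), (U y + K * v y : ℝ≥0∞) ∂μ :=
          (lintegral_mono fun y => le_self_add).trans (lintegral_mono_set inter_subset_left)
      _ ≤ τ * (5 ^ n * m) := by
          rw [← h5]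
          exact hdouble _ (by linarith)
      _ = _ := by
          rw [hmeq]
          ring

/-- The inequality between level sets: the mass of `U` above the level `Λ τ` is a small multiple of
the mass of `U` above `τ / 4`, up to terms in `v` and `σ`. It is the sum of the estimates on a
disjoint family of stopping balls. -/
theorem withDensity_setOf_lt_le [Nontrivial E] {N C₁ C₂ : ℝ≥0} {θ : ℝ} {U v σ : E → ℝ≥0}
    (h : HasLocalDecomposition μ N C₁ C₂ θ U v σ) (hU : Measurable U) (hv : Measurable v)
    (hU' : ∫⁻ y, U y ∂μ ≠ ∞) (hv' : ∫⁻ y, v y ∂μ ≠ ∞)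
    (hN : 1 ≤ N) (hθ : 1 ≤ θ) {τ K Λ : ℝ≥0} (hτ : τ ≠ 0) (hK : 1 ≤ K) (hΛ : 1 ≤ Λ) :
    μ.withDensity (fun y => (U y : ℝ≥0∞)) {y | Λ * τ < U y} ≤
      2 * decompositionConst N C₁ C₂ (finrank ℝ E) θ K Λ *
        (μ.withDensity (fun y => (U y : ℝ≥0∞)) {y | τ / 4 < U y} +
          K * μ.withDensity (fun y => (v y : ℝ≥0∞)) {y | τ / (4 * K) < v y}) +
      5 ^ finrank ℝ E * τ * μ {y | τ < σ y} := by
  have hK0 : K ≠ 0 := (one_pos.trans_le hK).ne'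
  set ε := decompositionConst N C₁ C₂ (finrank ℝ E) θ K Λ
  set ν₁ := μ.withDensity (fun y => (U y : ℝ≥0∞)) with hν₁
  set ν₂ := μ.withDensity (fun y => (v y : ℝ≥0∞))
  set M : Measure E := (2 * ε) • (ν₁.restrict {y | τ / 4 < U y} +
    K • ν₂.restrict {y | τ / (4 * K) < v y}) +
    (5 ^ finrank ℝ E * τ) • μ.restrict {y | τ < σ y} with hM
  have hMB : ∀ B, MeasurableSet B → M B = 2 * ε * (ν₁ (B ∩ {y | τ / 4 < U y}) +
      K * ν₂ (B ∩ {y | τ / (4 * K) < v y})) +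
      5 ^ finrank ℝ E * τ * μ (B ∩ {y | τ < σ y}) := by
    intro B hB
    simp only [hM, Measure.add_apply, Measure.smul_apply, Measure.restrict_apply hB,
      ENNReal.smul_def, smul_eq_mul]
    push_cast
    ring
  have hMu := hMB univ MeasurableSet.univ
  simp only [univ_inter] at hMu
  rw [← hMu]
  have hw : Measurable fun y => (U y + K * v y : ℝ≥0∞) := by fun_prop
  have hwi : ∫⁻ y, (U y + K * v y : ℝ≥0∞) ∂μ ≠ ∞ := by
    rw [lintegral_add_left hU.coe_nnreal_ennreal, lintegral_const_mul _ hv.coe_nnreal_ennreal]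
    finiteness
  obtain ⟨R, hR⟩ := ae_exists_stopping_radius (μ := μ) hw hwi
    (τ := τ) (by exact_mod_cast hτ) ENNReal.coe_ne_top
  refine measure_le_of_forall_closedBall (withDensity_absolutelyContinuous μ _) (R := R) ?_
  filter_upwards [hR] with x hx hxS
  have hxτ : (τ : ℝ≥0∞) < U x + K * v x := by
    have h1 : τ < U x := lt_of_le_of_lt (le_mul_of_one_le_left zero_le hΛ) hxS
    exact lt_of_lt_of_le (by exact_mod_cast h1) le_self_add
  obtain ⟨r, hr, hrR, hlt, hdouble⟩ := hx hxτ
  refine ⟨r, hr, hrR, ?_⟩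
  rw [hMB _ measurableSet_closedBall]
  refine (withDensity_closedBall_inter_le h hU hN hθ hτ hK (one_pos.trans_le hΛ).ne' hr
    hdouble).trans ?_
  have := mul_measure_le_of_lt_setLIntegral hU hv measure_closedBall_lt_top.ne hK0 hlt.le
  rw [mul_comm 2 (ε : ℝ≥0∞), mul_assoc (ε : ℝ≥0∞)]
  gcongr

end StoppingBalls

/-! ### Integration over the levels -/

section LayerCake

variable {α : Type*} [MeasurableSpace α]

theorem lintegral_coe_rpow_eq_lintegral_meas_lt_mul (ν : Measure α) {f : α → ℝ≥0}
    (hf : Measurable f) {p : ℝ} (hp : 0 < p) :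
    ∫⁻ x, (f x : ℝ≥0∞) ^ p ∂ν =
      ENNReal.ofReal p * ∫⁻ t in Ioi (0 : ℝ), ν {x | t < f x} * ENNReal.ofReal (t ^ (p - 1)) := by
  rw [← lintegral_rpow_eq_lintegral_meas_lt_mul ν (f := fun x => (f x : ℝ))
    (Eventually.of_forall fun x => (f x).coe_nonneg) hf.coe_nnreal_real.aemeasurable hp]
  refine lintegral_congr fun x => ?_
  rw [← ENNReal.ofReal_rpow_of_nonneg (f x).coe_nonneg hp.le, ENNReal.ofReal_coe_nnreal]

theorem lintegral_withDensity_rpow {μ : Measure α} {f : α → ℝ≥0} (hf : Measurable f) {s : ℝ}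
    (hs : 0 ≤ s) (c : ℝ≥0) :
    ∫⁻ x, ((c * f x : ℝ≥0) : ℝ≥0∞) ^ s ∂(μ.withDensity fun x => (f x : ℝ≥0∞)) =
      (c : ℝ≥0∞) ^ s * ∫⁻ x, (f x : ℝ≥0∞) ^ (s + 1) ∂μ := by
  rw [lintegral_withDensity_eq_lintegral_mul _ hf.coe_nnreal_ennreal (by fun_prop),
    ← lintegral_const_mul _ (by fun_prop)]
  refine lintegral_congr fun x => ?_
  rw [Pi.mul_apply, ENNReal.coe_mul, ENNReal.mul_rpow_of_nonneg _ _ hs,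
    ENNReal.rpow_add_of_nonneg _ _ hs zero_le_one, ENNReal.rpow_one]
  ring

/-- Integration of an inequality between level sets against `τ ^ (s - 1)`. -/
theorem lintegral_rpow_le_of_measure_lt_le {ν₁ ν₂ μ : Measure α} {f g h k : α → ℝ≥0}
    (hf : Measurable f) (hg : Measurable g) (hh : Measurable h) (hk : Measurable k)
    {s : ℝ} (hs : 0 < s) {a b c : ℝ≥0∞}
    (H : ∀ τ : ℝ≥0, τ ≠ 0 →
      ν₁ {x | τ < f x} ≤ a * ν₁ {x | τ < g x} + b * ν₂ {x | τ < h x} + c * τ * μ {x | τ < k x}) :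
    ∫⁻ x, (f x : ℝ≥0∞) ^ s ∂ν₁ ≤ a * ∫⁻ x, (g x : ℝ≥0∞) ^ s ∂ν₁ + b * ∫⁻ x, (h x : ℝ≥0∞) ^ s ∂ν₂ +
      c * ∫⁻ x, (k x : ℝ≥0∞) ^ (s + 1) ∂μ := by
  have hm : ∀ (ν : Measure α) (u : α → ℝ≥0) (e : ℝ),
      Measurable fun t : ℝ => ν {x | t < u x} * ENNReal.ofReal (t ^ e) := by
    intro ν u e
    have h1 : Antitone fun t : ℝ => ν {x | t < u x} := fun t t' htt' =>
      measure_mono fun x hx => lt_of_le_of_lt htt' hx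
    have h2 : Measurable fun t : ℝ => ENNReal.ofReal (t ^ e) := by fun_prop
    exact h1.measurable.mul h2
  rw [lintegral_coe_rpow_eq_lintegral_meas_lt_mul ν₁ hf hs,
    lintegral_coe_rpow_eq_lintegral_meas_lt_mul ν₁ hg hs,
    lintegral_coe_rpow_eq_lintegral_meas_lt_mul ν₂ hh hs,
    lintegral_coe_rpow_eq_lintegral_meas_lt_mul μ hk (by linarith : 0 < s + 1)]
  set G := ∫⁻ t in Ioi (0 : ℝ), ν₁ {x | t < g x} * ENNReal.ofReal (t ^ (s - 1)) with hG
  set H' := ∫⁻ t in Ioi (0 : ℝ), ν₂ {x | t < h x} * ENNReal.ofReal (t ^ (s - 1)) with hH'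
  set K := ∫⁻ t in Ioi (0 : ℝ), μ {x | t < k x} * ENNReal.ofReal (t ^ (s + 1 - 1)) with hK
  have key : ∫⁻ t in Ioi (0 : ℝ), ν₁ {x | t < f x} * ENNReal.ofReal (t ^ (s - 1)) ≤
      a * G + b * H' + c * K := by
    calc ∫⁻ t in Ioi (0 : ℝ), ν₁ {x | t < f x} * ENNReal.ofReal (t ^ (s - 1))
        ≤ ∫⁻ t in Ioi (0 : ℝ), (a * (ν₁ {x | t < g x} * ENNReal.ofReal (t ^ (s - 1))) +
            b * (ν₂ {x | t < h x} * ENNReal.ofReal (t ^ (s - 1))) +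
            c * (μ {x | t < k x} * ENNReal.ofReal (t ^ (s + 1 - 1)))) := by
          refine setLIntegral_mono' measurableSet_Ioi fun t ht => ?_
          have ht0 : (0 : ℝ) < t := ht
          lift t to ℝ≥0 using ht0.le
          have h1 := H t (by exact_mod_cast ht0.ne')
          have h2 : ENNReal.ofReal ((t : ℝ) ^ (s + 1 - 1)) =
              t * ENNReal.ofReal ((t : ℝ) ^ (s - 1)) := by
            rw [show s + 1 - 1 = 1 + (s - 1) by ring, Real.rpow_add ht0, Real.rpow_one,
              ENNReal.ofReal_mul ht0.le, ENNReal.ofReal_coe_nnreal]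
          simp only [NNReal.coe_lt_coe]
          calc _ ≤ (a * ν₁ {x | t < g x} + b * ν₂ {x | t < h x} + c * t * μ {x | t < k x}) *
                ENNReal.ofReal ((t : ℝ) ^ (s - 1)) := by gcongr
            _ = _ := by
              rw [h2]
              ring
      _ = a * G + b * H' + c * K := by
          rw [lintegral_add_right _ ((hm μ k _).const_mul c),
            lintegral_add_right _ ((hm ν₂ h _).const_mul b),
            lintegral_const_mul _ (hm ν₁ g _),
            lintegral_const_mul _ (hm ν₂ h _),
            lintegral_const_mul _ (hm μ k _)]
  calc _ ≤ ENNReal.ofReal s * (a * G + b * H' + c * K) := by gcongr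
    _ = a * (ENNReal.ofReal s * G) + b * (ENNReal.ofReal s * H') + c * (ENNReal.ofReal s * K) := by
        ring
    _ ≤ _ := by
        gcongr
        linarith

end LayerCake

section RealVariable

variable {E : Type*} [NormedAddCommGroup E] [NormedSpace ℝ E] [FiniteDimensional ℝ E]
  [MeasurableSpace E] [BorelSpace E] {μ : Measure E} [μ.IsAddHaarMeasure]

/-- The parameters `Λ` and then `K` can be chosen so large that the first term on the right of
the level set inequality can be absorbed. Here `s < θ - 1` is what makes the power of `Λ` win. -/
theorem exists_decompositionConst_mul_le (N C₁ C₂ : ℝ≥0) (n : ℕ) {θ s : ℝ} (hsθ : s < θ - 1)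
    {δ : ℝ≥0} (hδ : 0 < δ) :
    ∃ K Λ : ℝ≥0, 1 ≤ K ∧ 1 ≤ Λ ∧ decompositionConst N C₁ C₂ n θ K Λ * Λ ^ s ≤ δ := by
  set A : ℝ≥0 := 2 * C₂ * 5 ^ n * (N ^ n) ^ θ with hA
  set D : ℝ≥0 := 2 * C₁ * N ^ n * 5 ^ n with hD
  have h1 : Tendsto (fun L : ℝ≥0 => A * (2 ^ (θ - 1) * L ^ (-(θ - 1 - s)))) atTop (𝓝 0) := by
    have h0 : Tendsto (fun L : ℝ≥0 => L ^ (-(θ - 1 - s))) atTop (𝓝 0) := by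
      rw [← NNReal.tendsto_coe]
      simp only [NNReal.coe_rpow]
      exact (tendsto_rpow_neg_atTop (by linarith : 0 < θ - 1 - s)).comp
        (NNReal.tendsto_coe_atTop.2 tendsto_id)
    simpa using (h0.const_mul _).const_mul A
  obtain ⟨Λ, hΛ, hΛ1⟩ := ((h1.eventually (gt_mem_nhds (half_pos hδ))).and
    (eventually_ge_atTop 1)).exists
  have hΛ0 : Λ ≠ 0 := (one_pos.trans_le hΛ1).ne'
  refine ⟨max 1 (D * Λ ^ s * (2 / δ)), Λ, le_max_left _ _, hΛ1, ?_⟩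
  set K := max 1 (D * Λ ^ s * (2 / δ))
  have hK0 : 0 < K := one_pos.trans_le (le_max_left _ _)
  have h2 : (Λ / 2) ^ (1 - θ) * Λ ^ s = 2 ^ (θ - 1) * Λ ^ (-(θ - 1 - s)) := by
    rw [NNReal.div_rpow, show -(θ - 1 - s) = (1 - θ) + s by ring, NNReal.rpow_add hΛ0,
      show θ - 1 = -(1 - θ) by ring, NNReal.rpow_neg 2]
    field_simp
  have h3 : D * K⁻¹ * Λ ^ s ≤ δ / 2 := by
    have h4 : D * Λ ^ s * (2 / δ) ≤ K := le_max_right _ _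
    have h5 : D * Λ ^ s ≤ δ / 2 * K := by
      calc D * Λ ^ s = δ / 2 * (D * Λ ^ s * (2 / δ)) := by field_simp
        _ ≤ _ := by gcongr
    calc D * K⁻¹ * Λ ^ s = D * Λ ^ s / K := by field_simp
      _ ≤ δ / 2 := (div_le_iff₀ hK0).2 h5
  calc decompositionConst N C₁ C₂ n θ K Λ * Λ ^ s
      = D * K⁻¹ * Λ ^ s + A * ((Λ / 2) ^ (1 - θ) * Λ ^ s) := by
        rw [decompositionConst]
        ring
    _ ≤ δ / 2 + δ / 2 := by
        rw [h2]
        exact add_le_add h3 hΛ.le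
    _ = δ := add_halves δ

theorem le_two_mul_of_le_half_add {J R : ℝ≥0∞} (hJ : J ≠ ∞) {e : ℝ≥0∞} (he : e ≤ 1 / 2)
    (h : J ≤ e * J + R) : J ≤ 2 * R := by
  have h1 : J ≤ J / 2 + R := h.trans (by
    gcongr
    rw [ENNReal.div_eq_inv_mul]
    gcongr
    simpa using he)
  have h2 : J / 2 ≤ R := by
    have h3 : J / 2 + J / 2 ≤ J / 2 + R := by rwa [ENNReal.add_halves]
    exact (ENNReal.add_le_add_iff_left (by finiteness)).1 h3
  calc J = 2 * (J / 2) := (ENNReal.mul_div_cancel (by simp) (by simp)).symm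
    _ ≤ 2 * R := by gcongr

/-- The absorbed estimate for `U` truncated at height `Λ T`. The truncation makes the integral
which is absorbed finite, and the bound does not depend on it. -/
theorem lintegral_min_rpow_le [Nontrivial E] {N C₁ C₂ : ℝ≥0} {θ s : ℝ} {U v σ : E → ℝ≥0}
    (h : HasLocalDecomposition μ N C₁ C₂ θ U v σ) (hU : Measurable U) (hv : Measurable v)
    (hσ : Measurable σ) (hU' : ∫⁻ y, U y ∂μ ≠ ∞) (hv' : ∫⁻ y, v y ∂μ ≠ ∞)
    (hN : 1 ≤ N) (hθ : 1 ≤ θ) (hs : 0 < s) {K Λ : ℝ≥0} (hK : 1 ≤ K) (hΛ : 1 ≤ Λ)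
    (hε : decompositionConst N C₁ C₂ (finrank ℝ E) θ K Λ * Λ ^ s ≤ (4 * 4 ^ s)⁻¹) (T : ℝ≥0) :
    ∫⁻ x, ((min (Λ * T) (U x) : ℝ≥0) : ℝ≥0∞) ^ s ∂(μ.withDensity fun y => (U y : ℝ≥0∞)) ≤
      2 * ((Λ : ℝ≥0∞) ^ s * (2 * decompositionConst N C₁ C₂ (finrank ℝ E) θ K Λ * K *
        (((4 * K : ℝ≥0) : ℝ≥0∞) ^ s * ∫⁻ x, (v x : ℝ≥0∞) ^ (s + 1) ∂μ) +
          5 ^ finrank ℝ E * ∫⁻ x, (σ x : ℝ≥0∞) ^ (s + 1) ∂μ)) := by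
  set ε := decompositionConst N C₁ C₂ (finrank ℝ E) θ K Λ with hεdef
  set n := finrank ℝ E
  set ν₁ := μ.withDensity (fun y => (U y : ℝ≥0∞)) with hν₁
  set ν₂ := μ.withDensity (fun y => (v y : ℝ≥0∞)) with hν₂
  have hK0 : 0 < K := one_pos.trans_le hK
  have hΛ0 : 0 < Λ := one_pos.trans_le hΛ
  set J := ∫⁻ x, ((min (Λ * T) (U x) : ℝ≥0) : ℝ≥0∞) ^ s ∂ν₁ with hJ
  have hJfin : J ≠ ∞ := by
    refine ne_top_of_le_ne_top (b := ((Λ * T : ℝ≥0) : ℝ≥0∞) ^ s * ∫⁻ y, U y ∂μ) ?_ ?_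
    · exact ENNReal.mul_ne_top (ENNReal.rpow_ne_top_of_nonneg hs.le ENNReal.coe_ne_top) hU'
    · calc J ≤ ∫⁻ _, ((Λ * T : ℝ≥0) : ℝ≥0∞) ^ s ∂ν₁ := by
            refine lintegral_mono fun x => ?_
            gcongr
            exact min_le_left _ _
        _ = _ := by
            rw [lintegral_const, hν₁, withDensity_apply _ MeasurableSet.univ,
              Measure.restrict_univ]
  have hlevel := lintegral_rpow_le_of_measure_lt_le (ν₁ := ν₁) (ν₂ := ν₂) (μ := μ)
    (f := fun x => min T (U x / Λ)) (g := fun x => min T (4 * U x)) (h := fun x => 4 * K * v x)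
    (k := σ) (by fun_prop) (by fun_prop) (by fun_prop) hσ hs (a := 2 * ε) (b := 2 * ε * K)
    (c := 5 ^ n) (by
      intro τ hτ
      by_cases hτT : τ < T
      · have h1 := withDensity_setOf_lt_le h hU hv hU' hv' hN hθ hτ hK hΛ
        have e1 : ∀ x, (τ < min T (U x / Λ)) = (Λ * τ < U x) := fun x => by
          rw [lt_min_iff, lt_div_iff₀ hΛ0, mul_comm τ]
          simp [hτT]
        have e2 : ∀ x, (τ < min T (4 * U x)) = (τ / 4 < U x) := fun x => by
          rw [lt_min_iff, div_lt_iff₀ (by norm_num), mul_comm (U x)]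
          simp [hτT]
        have e3 : ∀ x, (τ < 4 * K * v x) = (τ / (4 * K) < v x) := fun x => by
          rw [div_lt_iff₀ (by positivity), mul_comm (v x)]
        simp only [e1, e2, e3]
        refine h1.trans (le_of_eq ?_)
        ring
      · simp [hτT])
  have hA : ∫⁻ x, ((min T (U x / Λ) : ℝ≥0) : ℝ≥0∞) ^ s ∂ν₁ = ((Λ⁻¹ : ℝ≥0) : ℝ≥0∞) ^ s * J := by
    rw [hJ, ← lintegral_const_mul _ (by fun_prop)]
    refine lintegral_congr fun x => ?_
    rw [← ENNReal.mul_rpow_of_nonneg _ _ hs.le, ← ENNReal.coe_mul]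
    congr 2
    rw [mul_min_of_nonneg _ _ zero_le]
    congr 1 <;> field_simp
  have hB : ∫⁻ x, ((min T (4 * U x) : ℝ≥0) : ℝ≥0∞) ^ s ∂ν₁ ≤ ((4 : ℝ≥0) : ℝ≥0∞) ^ s * J := by
    rw [hJ, ← lintegral_const_mul _ (by fun_prop)]
    refine lintegral_mono fun x => ?_
    rw [← ENNReal.mul_rpow_of_nonneg _ _ hs.le, ← ENNReal.coe_mul]
    gcongr
    rw [mul_min_of_nonneg _ _ zero_le]
    refine min_le_min ?_ le_rfl
    rw [← mul_assoc]
    exact le_mul_of_one_le_left zero_le (one_le_mul (by norm_num) hΛ)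
  rw [hA, lintegral_withDensity_rpow hv hs.le] at hlevel
  set R := 2 * ε * K * (((4 * K : ℝ≥0) : ℝ≥0∞) ^ s * ∫⁻ x, (v x : ℝ≥0∞) ^ (s + 1) ∂μ) +
          5 ^ n * ∫⁻ x, (σ x : ℝ≥0∞) ^ (s + 1) ∂μ with hR
  have hcancel : (Λ : ℝ≥0∞) ^ s * ((Λ⁻¹ : ℝ≥0) : ℝ≥0∞) ^ s = 1 := by
    rw [← ENNReal.mul_rpow_of_nonneg _ _ hs.le, ← ENNReal.coe_mul, mul_inv_cancel₀ hΛ0.ne']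
    simp
  refine le_two_mul_of_le_half_add hJfin (e := (Λ : ℝ≥0∞) ^ s * (2 * ε * ((4 : ℝ≥0) : ℝ≥0∞) ^ s))
    ?_ ?_
  · have h1 : Λ ^ s * (2 * ε * 4 ^ s) ≤ 1 / 2 := by
      calc Λ ^ s * (2 * ε * 4 ^ s) = 2 * 4 ^ s * (ε * Λ ^ s) := by ring
        _ ≤ 2 * 4 ^ s * (4 * 4 ^ s)⁻¹ := by gcongr
        _ = 1 / 2 := by
          have : (4 : ℝ≥0) ^ s ≠ 0 := by positivity
          field_simp
          norm_num
    rw [← ENNReal.coe_rpow_of_nonneg _ hs.le, ← ENNReal.coe_rpow_of_nonneg _ hs.le]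
    have h2 := ENNReal.coe_le_coe.2 h1
    simpa using h2
  · calc J = (Λ : ℝ≥0∞) ^ s * (((Λ⁻¹ : ℝ≥0) : ℝ≥0∞) ^ s * J) := by
          rw [← mul_assoc, hcancel, one_mul]
      _ ≤ (Λ : ℝ≥0∞) ^ s * (2 * ε * (((4 : ℝ≥0) : ℝ≥0∞) ^ s * J) + R) := by
          rw [hR, ← add_assoc]
          gcongr
          refine hlevel.trans ?_
          gcongr
      _ = _ := by ring

/-- The real-variable theorem: a function with local decompositions of exponent `θ` is controlled
in `L ^ ρ` for `1 < ρ < θ`, with a constant depending only on the parameters. -/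
theorem exists_lintegral_rpow_le [Nontrivial E] (N C₁ C₂ : ℝ≥0) (hN : 1 ≤ N) {θ ρ : ℝ}
    (hρ : 1 < ρ) (hρθ : ρ < θ) :
    ∃ A : ℝ≥0, ∀ U v σ : E → ℝ≥0, Measurable U → Measurable v → Measurable σ →
      ∫⁻ y, U y ∂μ ≠ ∞ → ∫⁻ y, v y ∂μ ≠ ∞ → HasLocalDecomposition μ N C₁ C₂ θ U v σ →
      ∫⁻ y, (U y : ℝ≥0∞) ^ ρ ∂μ ≤
        A * (∫⁻ y, (v y : ℝ≥0∞) ^ ρ ∂μ + ∫⁻ y, (σ y : ℝ≥0∞) ^ ρ ∂μ) := by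
  obtain ⟨s, rfl⟩ : ∃ s, ρ = s + 1 := ⟨ρ - 1, by ring⟩
  have hs : 0 < s := by linarith
  obtain ⟨K, Λ, hK, hΛ, hε⟩ := exists_decompositionConst_mul_le N C₁ C₂ (finrank ℝ E)
    (show s < θ - 1 by linarith) (show (0 : ℝ≥0) < (4 * 4 ^ s)⁻¹ by positivity)
  have hΛ0 : 0 < Λ := one_pos.trans_le hΛ
  set ε := decompositionConst N C₁ C₂ (finrank ℝ E) θ K Λ with hεdef
  refine ⟨2 * Λ ^ s * (2 * ε * K * (4 * K) ^ s + 5 ^ finrank ℝ E), ?_⟩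
  intro U v σ hU hv hσ hU' hv' h
  have hbound := lintegral_min_rpow_le h hU hv hσ hU' hv' hN (by linarith) hs hK hΛ hε
  have hlim := lintegral_tendsto_of_tendsto_of_monotone
    (μ := μ.withDensity fun y => (U y : ℝ≥0∞))
    (f := fun (k : ℕ) x => ((min (Λ * k) (U x) : ℝ≥0) : ℝ≥0∞) ^ s)
    (F := fun x => ((1 * U x : ℝ≥0) : ℝ≥0∞) ^ s)
    (fun k => (by fun_prop : Measurable _).aemeasurable)
    (Eventually.of_forall fun x i j hij => by
      dsimp only
      gcongr)
    (Eventually.of_forall fun x => by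
      refine tendsto_const_nhds.congr' ?_
      obtain ⟨k₀, hk₀⟩ := exists_nat_ge (U x / Λ)
      filter_upwards [eventually_ge_atTop k₀] with k hk
      have h1 : U x / Λ ≤ k := hk₀.trans (by exact_mod_cast hk)
      rw [div_le_iff₀ hΛ0, mul_comm] at h1
      rw [min_eq_right h1, one_mul])
  rw [lintegral_withDensity_rpow hU hs.le] at hlim
  simp only [ENNReal.coe_one, ENNReal.one_rpow, one_mul] at hlim
  refine (le_of_tendsto' hlim fun k => hbound k).trans ?_
  rw [← ENNReal.coe_rpow_of_nonneg _ hs.le, ← ENNReal.coe_rpow_of_nonneg _ hs.le]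
  set V := ∫⁻ y, (v y : ℝ≥0∞) ^ (s + 1) ∂μ
  set W := ∫⁻ y, (σ y : ℝ≥0∞) ^ (s + 1) ∂μ
  push_cast
  have h1 : (2 * ε * K * ((4 * K : ℝ≥0) ^ s : ℝ≥0) * V : ℝ≥0∞) ≤
      2 * ε * K * ((4 * K : ℝ≥0) ^ s : ℝ≥0) * (V + W) := by
    gcongr
    exact le_self_add
  have h2 : (5 ^ finrank ℝ E * W : ℝ≥0∞) ≤ 5 ^ finrank ℝ E * (V + W) := by
    gcongr
    exact le_add_self
  calc _ = 2 * (Λ ^ s : ℝ≥0) * (2 * ε * K * ((4 * K : ℝ≥0) ^ s : ℝ≥0) * V +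
        5 ^ finrank ℝ E * W : ℝ≥0∞) := by ring
    _ ≤ 2 * (Λ ^ s : ℝ≥0) * (2 * ε * K * ((4 * K : ℝ≥0) ^ s : ℝ≥0) * (V + W) +
        5 ^ finrank ℝ E * (V + W) : ℝ≥0∞) := by gcongr
    _ = _ := by ring

end RealVariable

/-! ### Cubes, averages and operators -/

section Cubes

variable {d : ℕ}

theorem closedBall_subset_cube (c : EuclideanSpace ℝ (Fin d)) (r : ℝ) :
    closedBall c r ⊆ cube c r := by
  intro x hx i
  rw [mem_closedBall, dist_eq_norm] at hx
  exact (PiLp.norm_apply_le (x - c) i).trans hx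

theorem cube_subset_closedBall (c : EuclideanSpace ℝ (Fin d)) {r : ℝ} (hr : 0 ≤ r) :
    cube c r ⊆ closedBall c ((d + 1) * r) := by
  intro x hx
  rw [mem_closedBall, dist_eq_norm, EuclideanSpace.norm_eq]
  refine Real.sqrt_le_iff.2 ⟨by positivity, ?_⟩
  calc ∑ i, ‖(x - c) i‖ ^ 2 ≤ ∑ _i : Fin d, r ^ 2 := by
        gcongr with i
        exact hx i
    _ = d * r ^ 2 := by simp
    _ ≤ ((d + 1) * r) ^ 2 := by
        rw [mul_pow]
        gcongr
        nlinarith [(Nat.cast_nonneg d : (0 : ℝ) ≤ d)]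

theorem cube_mono (c : EuclideanSpace ℝ (Fin d)) {r s : ℝ} (h : r ≤ s) : cube c r ⊆ cube c s :=
  fun _ hx i => (hx i).trans h

theorem isClosed_cube (c : EuclideanSpace ℝ (Fin d)) (r : ℝ) : IsClosed (cube c r) := by
  rw [cube, ofPred_forall]
  exact isClosed_iInter fun i => isClosed_le (by fun_prop) continuous_const

theorem measurableSet_cube (c : EuclideanSpace ℝ (Fin d)) (r : ℝ) : MeasurableSet (cube c r) :=
  (isClosed_cube c r).measurableSet

theorem volume_cube_ne_top (c : EuclideanSpace ℝ (Fin d)) {r : ℝ} (hr : 0 ≤ r) :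
    volume (cube c r) ≠ ∞ :=
  ((measure_mono (cube_subset_closedBall c hr)).trans_lt measure_closedBall_lt_top).ne

theorem volume_cube_ne_zero (c : EuclideanSpace ℝ (Fin d)) {r : ℝ} (hr : 0 < r) :
    volume (cube c r) ≠ 0 :=
  ((measure_closedBall_pos volume c hr).trans_le (measure_mono (closedBall_subset_cube c r))).ne'

theorem cube_subset_interior_cube (c : EuclideanSpace ℝ (Fin d)) {r s : ℝ} (h : r < s) :
    cube c r ⊆ interior (cube c s) := by
  have ho : IsOpen {x : EuclideanSpace ℝ (Fin d) | ∀ i, |x i - c i| < s} := by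
    rw [ofPred_forall]
    exact isOpen_iInter_of_finite fun i => isOpen_lt (by fun_prop) continuous_const
  exact fun x hx => interior_maximal (fun y hy i => (hy i).le) ho fun i => (hx i).trans_lt h

theorem tsupport_indicator_compl_cube_subset {F : Type*} [Zero F] (c : EuclideanSpace ℝ (Fin d))
    {r s : ℝ} (h : r < s) (f : EuclideanSpace ℝ (Fin d) → F) :
    tsupport ((cube c s)ᶜ.indicator f) ⊆ (cube c r)ᶜ := by
  have h1 : tsupport ((cube c s)ᶜ.indicator f) ⊆ closure (cube c s)ᶜ :=
    closure_mono support_indicator_subset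
  rw [closure_compl] at h1
  exact h1.trans (compl_subset_compl.2 (cube_subset_interior_cube c h))

variable {m : ℕ}

theorem IsLinftyC.indicator {f : EuclideanSpace ℝ (Fin d) → EuclideanSpace ℝ (Fin m)}
    (hf : IsLinftyC f) {s : Set (EuclideanSpace ℝ (Fin d))} (hs : MeasurableSet s) :
    IsLinftyC (s.indicator f) :=
  ⟨hf.memLp_top.indicator hs, hf.hasCompactSupport.mono (support_indicator.trans_subset
    inter_subset_right)⟩

theorem lpAverage_rpow_mul_volume {q : ℝ≥0∞} (hq : q ≠ 0) (hq' : q ≠ ∞)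
    {Q : Set (EuclideanSpace ℝ (Fin d))} (hQ : volume Q ≠ 0) (hQ' : volume Q ≠ ∞)
    (g : EuclideanSpace ℝ (Fin d) → EuclideanSpace ℝ (Fin m)) :
    lpAverage q Q g ^ q.toReal * volume Q = ∫⁻ x in Q, ‖g x‖ₑ ^ q.toReal := by
  have hqpos : 0 < q.toReal := ENNReal.toReal_pos hq hq'
  rw [lpAverage, eLpNorm_eq_lintegral_rpow_enorm_toReal hq hq', ← ENNReal.rpow_mul,
    one_div_mul_cancel hqpos.ne', ENNReal.rpow_one, lintegral_smul_measure, smul_eq_mul, mul_comm,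
    ← mul_assoc, ENNReal.mul_inv_cancel hQ hQ', one_mul]

/-- Averages with respect to the normalized measure increase with the exponent. -/
theorem lpAverage_mono_exponent {q q' : ℝ≥0∞} (hqq' : q ≤ q')
    {Q : Set (EuclideanSpace ℝ (Fin d))} (hQ : volume Q ≠ 0) (hQ' : volume Q ≠ ∞)
    {g : EuclideanSpace ℝ (Fin d) → EuclideanSpace ℝ (Fin m)} (hg : AEStronglyMeasurable g) :
    lpAverage q Q g ≤ lpAverage q' Q g := by
  have : IsProbabilityMeasure ((volume Q)⁻¹ • volume.restrict Q) := by
    refine ⟨?_⟩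
    rw [Measure.smul_apply, Measure.restrict_apply_univ, smul_eq_mul, ENNReal.inv_mul_cancel hQ hQ']
  exact eLpNorm_le_eLpNorm_of_exponent_le hqq' (hg.restrict.smul_measure _)

end Cubes

section Operators

variable {d m : ℕ} {p : ℝ≥0∞}

theorem IsBoundedOnLp.exists_eLpNorm_le {T : LpVec d m p → LpVec d m p} (hT : IsBoundedOnLp T) :
    ∃ B : ℝ≥0, ∀ φ : LpVec d m p, eLpNorm (T φ) p volume ≤ B * eLpNorm φ p volume := by
  obtain ⟨B, hB⟩ := hT
  refine ⟨B.toNNReal, fun φ => ?_⟩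
  rw [← Lp.enorm_def, ← Lp.enorm_def, enorm_eq_nnnorm, enorm_eq_nnnorm, ← ENNReal.coe_mul,
    ENNReal.coe_le_coe, ← NNReal.coe_le_coe]
  exact (hB φ).trans (mul_le_mul_of_nonneg_right (Real.le_coe_toNNReal B) ENNReal.toReal_nonneg)

theorem lintegral_rpow_enorm_le_of_eLpNorm_le (hp : p ≠ 0) (hp' : p ≠ ∞) {B : ℝ≥0∞}
    {f g : EuclideanSpace ℝ (Fin d) → EuclideanSpace ℝ (Fin m)}
    (h : eLpNorm f p volume ≤ B * eLpNorm g p volume) :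
    ∫⁻ x, ‖f x‖ₑ ^ p.toReal ≤ B ^ p.toReal * ∫⁻ x, ‖g x‖ₑ ^ p.toReal := by
  have hpos : 0 < p.toReal := ENNReal.toReal_pos hp hp'
  have key : ∀ u : EuclideanSpace ℝ (Fin d) → EuclideanSpace ℝ (Fin m),
      ∫⁻ x, ‖u x‖ₑ ^ p.toReal = eLpNorm u p volume ^ p.toReal := fun u => by
    rw [eLpNorm_eq_lintegral_rpow_enorm_toReal hp hp', ← ENNReal.rpow_mul,
      one_div_mul_cancel hpos.ne', ENNReal.rpow_one]
  rw [key, key, ← ENNReal.mul_rpow_of_nonneg _ _ hpos.le]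
  gcongr

/-- A linear operator which is monotone on componentwise absolute values maps these to vectors
with nonnegative components, so it is monotone in norm as well. -/
theorem IsAbsMonotone.enorm_le {S : LpVec d m p →ₗ[ℝ] LpVec d m p} (hS : IsAbsMonotone S)
    {g h : LpVec d m p} (hgh : ∀ᵐ x, ∀ i, |g x i| ≤ |h x i|) :
    ∀ᵐ x, ‖S (lpAbs g) x‖ₑ ≤ ‖S (lpAbs h) x‖ₑ := by
  have habs0 : lpAbs (0 : LpVec d m p) = 0 := by
    refine Lp.ext ?_
    filter_upwards [coeFn_lpAbs (0 : LpVec d m p),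
      Lp.coeFn_zero (EuclideanSpace ℝ (Fin m)) p (volume : Measure (EuclideanSpace ℝ (Fin d)))]
      with x h1 h2
    rw [h1, h2, Pi.zero_apply, vecAbs_zero]
  have h0 : ∀ᵐ x, ∀ i, S (lpAbs 0) x i ≤ S (lpAbs g) x i := by
    refine hS 0 g ?_
    filter_upwards [Lp.coeFn_zero (EuclideanSpace ℝ (Fin m)) p
      (volume : Measure (EuclideanSpace ℝ (Fin d)))] with x hx i
    rw [hx]
    simp
  rw [habs0, map_zero] at h0
  filter_upwards [h0, hS g h hgh, Lp.coeFn_zero (EuclideanSpace ℝ (Fin m)) p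
    (volume : Measure (EuclideanSpace ℝ (Fin d)))] with x h1 h2 h3
  rw [h3] at h1
  rw [enorm_le_iff_norm_le, EuclideanSpace.norm_eq, EuclideanSpace.norm_eq]
  refine Real.sqrt_le_sqrt (Finset.sum_le_sum fun i _ => ?_)
  have h4 : 0 ≤ S (lpAbs g) x i := by simpa using h1 i
  rw [Real.norm_of_nonneg h4, Real.norm_of_nonneg (h4.trans (h2 i))]
  gcongr
  exact h2 i

theorem enorm_rpow_le_of_norm_le_add {F : Type*} [NormedAddCommGroup F] {x y z : F} {a : ℝ}
    (ha : 1 ≤ a) (h : ‖x‖ ≤ ‖y‖ + ‖z‖) :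
    ‖x‖ₑ ^ a ≤ 2 ^ (a - 1) * (‖y‖ₑ ^ a + ‖z‖ₑ ^ a) := by
  have h1 : ‖x‖ₑ ≤ ‖y‖ₑ + ‖z‖ₑ := by
    simp only [enorm_eq_nnnorm]
    exact_mod_cast h
  exact (ENNReal.rpow_le_rpow h1 (by linarith)).trans
    (by simpa [mul_add] using ENNReal.rpow_add_le_mul_rpow_add_rpow ‖y‖ₑ ‖z‖ₑ ha)

/-- In dimension zero all functions are constant and all `L ^ p` norms agree. -/
theorem eLpNorm_eq_eLpNorm_of_isEmpty {ι F : Type*} [Fintype ι] [IsEmpty ι] [NormedAddCommGroup F]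
    (g : EuclideanSpace ℝ ι → F) {p q : ℝ≥0∞} (hp : p ≠ 0) (hq : q ≠ 0) :
    eLpNorm g p volume = eLpNorm g q volume := by
  have hg : g = fun _ => g 0 := funext fun x => by rw [Subsingleton.elim x 0]
  have hv : (volume : Measure (EuclideanSpace ℝ ι)) ≠ 0 := by
    rw [volume_euclideanSpace_eq_dirac]
    exact Measure.dirac_ne_zero
  rw [hg, eLpNorm_const _ hp hv, eLpNorm_const _ hq hv,
    volume_euclideanSpace_eq_dirac]
  simp

end Operators

/-! ### Local decompositions of `T f` -/

section Main

variable {d m : ℕ} {p₀ p q : ℝ≥0∞}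

/-- The operator-theoretic hypothesis in the form of local decompositions. On a ball `B` with centre
`x` and radius `r`, `f` is split into its restrictions `g` to the cube `cube x ((α₂ + 1) * r)` and
`h` to the complement of this cube; `G` comes from `T g` and is controlled by the boundedness of
`T`, `H` comes from `T h`, for which the assumed reverse Hölder inequality is available. -/
theorem exists_hasLocalDecomposition (hp₀ : 1 ≤ p₀) (hp₀q : p₀ < q) (hq : q ≠ ∞)
    {T : LpVec d m p₀ → LpVec d m p₀} (hTsub : IsSublinearOnLp T) (hTbdd : IsBoundedOnLp T)
    {S : LpVec d m p →ₗ[ℝ] LpVec d m p} (hSmono : IsAbsMonotone S)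
    {α₁ α₂ C : ℝ} (hα₁ : 1 < α₁) (hα₂ : α₁ < α₂)
    (hTS : ∀ (c : EuclideanSpace ℝ (Fin d)) (r : ℝ), 0 < r →
      ∀ (f : EuclideanSpace ℝ (Fin d) → EuclideanSpace ℝ (Fin m)) (hf : IsLinftyC f),
        tsupport f ⊆ (cube c (α₂ * r))ᶜ →
        ∀ᵐ x ∂(volume.restrict (cube c r)),
          lpAverage q (cube c r) (T (hf.toLpVec p₀)) ≤
            ENNReal.ofReal C *
              (lpAverage p₀ (cube c (α₁ * r)) (T (hf.toLpVec p₀)) +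
                ‖S (lpAbs (hf.toLpVec p)) x‖ₑ)) :
    ∃ N C₁ C₂ : ℝ≥0, 1 ≤ N ∧
      ∀ (f : EuclideanSpace ℝ (Fin d) → EuclideanSpace ℝ (Fin m)) (hf : IsLinftyC f),
        HasLocalDecomposition volume N C₁ C₂ (q.toReal / p₀.toReal)
          (fun x => ‖T (hf.toLpVec p₀) x‖₊ ^ p₀.toReal) (fun x => ‖hf.toLpVec p₀ x‖₊ ^ p₀.toReal)
          (fun x => ‖S (lpAbs (hf.toLpVec p)) x‖₊ ^ p₀.toReal) := by
  obtain ⟨B, hB⟩ := hTbdd.exists_eLpNorm_le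
  have hp₀0 : p₀ ≠ 0 := (one_pos.trans_le hp₀).ne'
  have hp₀' : p₀ ≠ ∞ := hp₀q.ne_top
  have hq0 : q ≠ 0 := (zero_le.trans_lt hp₀q).ne'
  set a := p₀.toReal with ha_def
  have ha : 1 ≤ a := by
    rw [ha_def, ← ENNReal.toReal_one]
    exact ENNReal.toReal_mono hp₀' hp₀
  have ha0 : 0 < a := by linarith
  have hqpos : 0 < q.toReal := ENNReal.toReal_pos hq0 hq
  have hTint : ∀ φ : LpVec d m p₀, ∫⁻ x, ‖T φ x‖ₑ ^ a ≤ (B : ℝ≥0∞) ^ a * ∫⁻ x, ‖φ x‖ₑ ^ a :=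
    fun φ => lintegral_rpow_enorm_le_of_eLpNorm_le hp₀0 hp₀' (hB φ)
  -- The cutoff cube is strictly larger than `cube x (α₂ * r)`, so that the closed support of the
  -- function cut off outside it avoids the latter.
  set β : ℝ := α₂ + 1 with hβ
  lift β to ℝ≥0 using (by linarith) with b hb
  set N : ℝ≥0 := (d + 1) * b with hN
  set D : ℝ≥0 := 2 ^ (a - 1) * (1 + B ^ a) with hD
  have hcoe : ∀ (y : EuclideanSpace ℝ (Fin m)), ((‖y‖₊ ^ a : ℝ≥0) : ℝ≥0∞) = ‖y‖ₑ ^ a := fun y => by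
    rw [ENNReal.coe_rpow_of_nonneg _ ha0.le, enorm_eq_nnnorm]
  refine ⟨N, 2 ^ (a - 1) * B ^ a, (2 ^ (a - 1)) ^ (q.toReal / a) * N ^ d *
    (C.toNNReal * (D ^ a⁻¹ + 1)) ^ q.toReal, ?_, fun f hf x r hr => ?_⟩
  · rw [← NNReal.coe_le_coe, hN]
    push_cast
    rw [hb]
    nlinarith [(Nat.cast_nonneg d : (0 : ℝ) ≤ d)]
  have hQN : cube x (b * r) ⊆ closedBall x (N * r) := by
    refine (cube_subset_closedBall x (by positivity)).trans (closedBall_subset_closedBall ?_)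
    rw [hN]
    push_cast
    rw [mul_assoc]
  have hQm := measurableSet_cube x (b * r)
  have hg := hf.indicator hQm
  have hh := hf.indicator hQm.compl
  set F := hf.toLpVec p₀ with hF
  set Fg := hg.toLpVec p₀ with hFg
  set Fh := hh.toLpVec p₀ with hFh
  have hsum : F = Fg + Fh := by
    rw [hF, hFg, hFh, IsLinftyC.toLpVec, IsLinftyC.toLpVec, IsLinftyC.toLpVec, ← MemLp.toLp_add]
    refine MemLp.toLp_congr _ _ (Eventually.of_forall fun y => ?_)
    exact (congrFun (indicator_self_add_compl (cube x (b * r)) f) y).symm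
  have hsub₁ : ∀ᵐ y, ‖T F y‖ ≤ ‖T Fg y‖ + ‖T Fh y‖ := by
    rw [hsum]
    exact hTsub Fg Fh
  -- Since `T` need not be homogeneous, `-g` takes the place of `g` when `h` is written as `f - g`.
  have hsub₂ : ∀ᵐ y, ‖T Fh y‖ ≤ ‖T F y‖ + ‖T (-Fg) y‖ := by
    have h1 : Fh = F + -Fg := by
      rw [hsum]
      abel
    conv in ‖T Fh _‖ => rw [h1]
    exact hTsub F (-Fg)
  have hgint : ∫⁻ y, ‖Fg y‖ₑ ^ a ≤ ∫⁻ y in closedBall x (N * r), ‖F y‖ₑ ^ a := by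
    calc ∫⁻ y, ‖Fg y‖ₑ ^ a = ∫⁻ y, (cube x (b * r)).indicator (fun y => ‖F y‖ₑ ^ a) y := by
          refine lintegral_congr_ae ?_
          filter_upwards [(hg.memLp p₀).coeFn_toLp, (hf.memLp p₀).coeFn_toLp] with y hy hy'
          have e1 : Fg y = (cube x (b * r)).indicator f y := hy
          have e2 : F y = f y := hy'
          rw [e1]
          by_cases hyQ : y ∈ cube x (b * r)
          · rw [indicator_of_mem hyQ, indicator_of_mem hyQ, e2]
          · rw [indicator_of_notMem hyQ, indicator_of_notMem hyQ]
            simp [ha0]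
      _ = ∫⁻ y in cube x (b * r), ‖F y‖ₑ ^ a := lintegral_indicator hQm _
      _ ≤ _ := lintegral_mono_set hQN
  have hnegint : ∫⁻ y, ‖(-Fg) y‖ₑ ^ a = ∫⁻ y, ‖Fg y‖ₑ ^ a := by
    refine lintegral_congr_ae ?_
    filter_upwards [Lp.coeFn_neg Fg] with y hy
    rw [hy, Pi.neg_apply, enorm_neg]
  have hmeas : ∀ φ : LpVec d m p₀, Measurable fun y => ‖φ y‖ₑ ^ a := fun φ =>
    (Lp.stronglyMeasurable φ).enorm.pow_const a
  simp only [hcoe]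
  refine ⟨fun y => 2 ^ (a - 1) * ‖T Fg y‖ₑ ^ a, fun y => 2 ^ (a - 1) * ‖T Fh y‖ₑ ^ a,
    (hmeas _).const_mul _, ?_, ?_, ?_⟩
  · filter_upwards [hsub₁] with y hy
    rw [← mul_add]
    exact enorm_rpow_le_of_norm_le_add ha hy
  · rw [lintegral_const_mul _ (hmeas _)]
    push_cast
    rw [ENNReal.coe_rpow_of_ne_zero two_ne_zero, ENNReal.coe_rpow_of_nonneg _ ha0.le, mul_assoc]
    push_cast
    gcongr
    exact (hTint Fg).trans (by gcongr)
  intro t hmass hfreq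
  have hP0 := volume_cube_ne_zero x hr
  have hP1 := volume_cube_ne_top x hr.le
  have hαr : 0 < α₁ * r := by positivity
  have hQ0 := volume_cube_ne_zero x hαr
  have hQ1 := volume_cube_ne_top x hαr.le
  have hBP : closedBall x r ⊆ cube x r := closedBall_subset_cube x r
  have hTh := hTS x r hr _ hh (tsupport_indicator_compl_cube_subset x
    (by rw [hb]; nlinarith) f)
  have hSh : ∀ᵐ y, ‖S (lpAbs (hh.toLpVec p)) y‖ₑ ≤ ‖S (lpAbs (hf.toLpVec p)) y‖ₑ := by
    refine hSmono.enorm_le ?_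
    filter_upwards [(hh.memLp p).coeFn_toLp, (hf.memLp p).coeFn_toLp] with y hy hy' i
    have e1 : hh.toLpVec p y = (cube x (b * r))ᶜ.indicator f y := hy
    have e2 : hf.toLpVec p y = f y := hy'
    rw [e1, e2]
    by_cases hyQ : y ∈ (cube x (b * r))ᶜ
    · rw [indicator_of_mem hyQ]
    · rw [indicator_of_notMem hyQ]
      simp
  -- The term with `S` is evaluated at a point of the ball where `σ` is small.
  obtain ⟨y, hyσ, hyT, hyS⟩ := (hfreq.and_eventually
    ((ae_restrict_of_ae_restrict_of_subset hBP hTh).and (ae_restrict_of_ae hSh))).exists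
  have hyσ' : ‖S (lpAbs (hf.toLpVec p)) y‖ₑ ≤ (t : ℝ≥0∞) ^ a⁻¹ := by
    rw [ENNReal.le_rpow_inv_iff ha0, ← hcoe]
    exact_mod_cast hyσ
  have hRH : lpAverage p₀ (cube x (α₁ * r)) (T Fh) ≤ (D : ℝ≥0∞) ^ a⁻¹ * (t : ℝ≥0∞) ^ a⁻¹ := by
    rw [← ENNReal.mul_rpow_of_nonneg _ _ (by positivity), ENNReal.le_rpow_inv_iff ha0]
    have h1 : lpAverage p₀ (cube x (α₁ * r)) (T Fh) ^ a * volume (cube x (α₁ * r)) ≤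
        D * t * volume (cube x (α₁ * r)) := by
      rw [lpAverage_rpow_mul_volume hp₀0 hp₀' hQ0 hQ1]
      have hsubN : cube x (α₁ * r) ⊆ closedBall x (N * r) := by
        refine (cube_mono x ?_).trans hQN
        rw [hb]
        gcongr
        linarith
      calc ∫⁻ y in cube x (α₁ * r), ‖T Fh y‖ₑ ^ a
          ≤ ∫⁻ y in cube x (α₁ * r), 2 ^ (a - 1) * (‖T F y‖ₑ ^ a + ‖T (-Fg) y‖ₑ ^ a) := by
            refine lintegral_mono_ae (ae_restrict_of_ae ?_)
            filter_upwards [hsub₂] with y hy using enorm_rpow_le_of_norm_le_add ha hy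
        _ = 2 ^ (a - 1) * ((∫⁻ y in cube x (α₁ * r), ‖T F y‖ₑ ^ a) +
              ∫⁻ y in cube x (α₁ * r), ‖T (-Fg) y‖ₑ ^ a) := by
            rw [lintegral_const_mul' _ _ (by finiteness), lintegral_add_left (hmeas _)]
        _ ≤ 2 ^ (a - 1) * ((∫⁻ y in closedBall x (N * r), ‖T F y‖ₑ ^ a) +
              (B : ℝ≥0∞) ^ a * ∫⁻ y in closedBall x (N * r), ‖F y‖ₑ ^ a) := by
            gcongr _ * (?_ + ?_)
            · exact lintegral_mono_set hsubN
            · refine (setLIntegral_le_lintegral _ _).trans ((hTint (-Fg)).trans ?_)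
              rw [hnegint]
              gcongr
        _ ≤ D * ∫⁻ y in closedBall x (N * r), (‖T F y‖ₑ ^ a + ‖F y‖ₑ ^ a) := by
            rw [lintegral_add_left (hmeas _), hD]
            push_cast
            rw [ENNReal.coe_rpow_of_ne_zero two_ne_zero, ENNReal.coe_rpow_of_nonneg _ ha0.le,
              mul_assoc]
            push_cast
            gcongr _ * ?_
            rw [mul_add]
            gcongr ?_ + ?_ * _
            · exact le_mul_of_one_le_left zero_le le_self_add
            · exact le_add_self
        _ ≤ D * (t * volume (closedBall x r)) := by gcongr
        _ ≤ D * (t * volume (cube x (α₁ * r))) := by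
            gcongr
            exact hBP.trans (cube_mono x (by nlinarith))
        _ = _ := by ring
    exact (ENNReal.mul_le_mul_iff_left hQ0 hQ1).1 h1
  have hAvg : lpAverage q (cube x r) (T Fh) ≤
      (C.toNNReal * (D ^ a⁻¹ + 1) : ℝ≥0) * (t : ℝ≥0∞) ^ a⁻¹ := by
    calc lpAverage q (cube x r) (T Fh)
        ≤ ENNReal.ofReal C * ((D : ℝ≥0∞) ^ a⁻¹ * (t : ℝ≥0∞) ^ a⁻¹ + (t : ℝ≥0∞) ^ a⁻¹) := by
          refine hyT.trans ?_
          gcongr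
          exact hyS.trans hyσ'
      _ = _ := by
          push_cast
          rw [ENNReal.coe_rpow_of_nonneg _ (by positivity : 0 ≤ a⁻¹), ENNReal.ofReal]
          ring
  have hPN : volume (cube x r) ≤ (N : ℝ≥0∞) ^ d * volume (closedBall x r) := by
    have h1 := measure_closedBall_mul (μ := volume) x N.coe_nonneg hr.le
    rw [ENNReal.ofReal_coe_nnreal, finrank_euclideanSpace, Fintype.card_fin] at h1
    rw [← h1]
    refine measure_mono ((cube_mono x ?_).trans hQN)
    exact le_mul_of_one_le_left hr.le (by linarith)
  have hθ0 : 0 ≤ q.toReal / a := by positivity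
  calc ∫⁻ y in closedBall x r, (2 ^ (a - 1) * ‖T Fh y‖ₑ ^ a) ^ (q.toReal / a)
      ≤ ∫⁻ y in cube x r, (2 ^ (a - 1) * ‖T Fh y‖ₑ ^ a) ^ (q.toReal / a) :=
        lintegral_mono_set hBP
    _ = (2 ^ (a - 1)) ^ (q.toReal / a) * ∫⁻ y in cube x r, ‖T Fh y‖ₑ ^ q.toReal := by
        rw [← lintegral_const_mul _ ((Lp.stronglyMeasurable _).enorm.pow_const _)]
        refine lintegral_congr fun y => ?_
        rw [ENNReal.mul_rpow_of_nonneg _ _ hθ0, ← ENNReal.rpow_mul ‖_‖ₑ, mul_div_cancel₀ _ ha0.ne']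
    _ ≤ (2 ^ (a - 1)) ^ (q.toReal / a) *
          (((C.toNNReal * (D ^ a⁻¹ + 1) : ℝ≥0) * (t : ℝ≥0∞) ^ a⁻¹) ^ q.toReal *
            ((N : ℝ≥0∞) ^ d * volume (closedBall x r))) := by
        rw [← lpAverage_rpow_mul_volume hq0 hq hP0 hP1]
        gcongr
    _ = _ := by
        clear_value N
        generalize C.toNNReal * (D ^ a⁻¹ + 1) = M
        rw [ENNReal.mul_rpow_of_nonneg _ _ hqpos.le, ← ENNReal.rpow_mul (t : ℝ≥0∞),
          show a⁻¹ * q.toReal = q.toReal / a by ring, ENNReal.coe_mul, ENNReal.coe_mul,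
          ENNReal.coe_rpow_of_nonneg _ hqpos.le, ENNReal.coe_rpow_of_nonneg _ hθ0,
          ENNReal.coe_rpow_of_ne_zero two_ne_zero]
        push_cast
        ring

/-- The bound for a finite exponent `q` in positive dimension: the real-variable theorem applied to
the local decompositions of `‖T f‖ ^ p₀`, followed by the boundedness of `S`. -/
theorem exists_eLpNorm_le_of_reverse_holder [NeZero d] (hp₀ : 1 ≤ p₀) (hp₀p : p₀ < p) (hpq : p < q)
    (hq : q ≠ ∞)
    {T : LpVec d m p₀ → LpVec d m p₀} (hTsub : IsSublinearOnLp T) (hTbdd : IsBoundedOnLp T)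
    {S : LpVec d m p →ₗ[ℝ] LpVec d m p} (hSmono : IsAbsMonotone S) (hSbdd : IsBoundedOnLp S)
    {α₁ α₂ C : ℝ} (hα₁ : 1 < α₁) (hα₂ : α₁ < α₂)
    (hTS : ∀ (c : EuclideanSpace ℝ (Fin d)) (r : ℝ), 0 < r →
      ∀ (f : EuclideanSpace ℝ (Fin d) → EuclideanSpace ℝ (Fin m)) (hf : IsLinftyC f),
        tsupport f ⊆ (cube c (α₂ * r))ᶜ →
        ∀ᵐ x ∂(volume.restrict (cube c r)),
          lpAverage q (cube c r) (T (hf.toLpVec p₀)) ≤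
            ENNReal.ofReal C *
              (lpAverage p₀ (cube c (α₁ * r)) (T (hf.toLpVec p₀)) +
                ‖S (lpAbs (hf.toLpVec p)) x‖ₑ)) :
    ∃ K : ℝ, 0 < K ∧
      ∀ (f : EuclideanSpace ℝ (Fin d) → EuclideanSpace ℝ (Fin m)) (hf : IsLinftyC f),
        eLpNorm (T (hf.toLpVec p₀)) p volume ≤ ENNReal.ofReal K * eLpNorm f p volume := by
  obtain ⟨N, C₁, C₂, hN, hdec⟩ := exists_hasLocalDecomposition hp₀ (hp₀p.trans hpq) hq hTsub hTbdd
    hSmono hα₁ hα₂ hTS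
  obtain ⟨Bs, hBs⟩ := hSbdd.exists_eLpNorm_le
  have hp₀0 : p₀ ≠ 0 := (one_pos.trans_le hp₀).ne'
  have hp₀' : p₀ ≠ ∞ := hp₀p.ne_top
  have hp0 : p ≠ 0 := (zero_le.trans_lt hp₀p).ne'
  have hp' : p ≠ ∞ := hpq.ne_top
  set a := p₀.toReal with ha_def
  set b := p.toReal with hb_def
  have ha0 : 0 < a := ENNReal.toReal_pos hp₀0 hp₀'
  have hb0 : 0 < b := ENNReal.toReal_pos hp0 hp'
  have hab : a < b := (ENNReal.toReal_lt_toReal hp₀' hp').2 hp₀p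
  have hbq : b < q.toReal := (ENNReal.toReal_lt_toReal hp' hq).2 hpq
  have : Nonempty (Fin d) := ⟨0⟩
  obtain ⟨A, hA⟩ := exists_lintegral_rpow_le (μ := (volume : Measure (EuclideanSpace ℝ (Fin d))))
    N C₁ C₂ hN (θ := q.toReal / a) (ρ := b / a) ((one_lt_div ha0).2 hab) (by gcongr)
  refine ⟨((A * (1 + Bs ^ b)) ^ (1 / b) : ℝ≥0) + 1, by positivity, fun f hf => ?_⟩
  have hcoe : ∀ (y : EuclideanSpace ℝ (Fin m)), ((‖y‖₊ ^ a : ℝ≥0) : ℝ≥0∞) = ‖y‖ₑ ^ a := fun y => by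
    rw [ENNReal.coe_rpow_of_nonneg _ ha0.le, enorm_eq_nnnorm]
  have hcoe' : ∀ (y : EuclideanSpace ℝ (Fin m)),
      ((‖y‖₊ ^ a : ℝ≥0) : ℝ≥0∞) ^ (b / a) = ‖y‖ₑ ^ b := fun y => by
    rw [hcoe, ← ENNReal.rpow_mul, mul_div_cancel₀ _ ha0.ne']
  have hfin : ∀ φ : LpVec d m p₀, ∫⁻ y, ((‖φ y‖₊ ^ a : ℝ≥0) : ℝ≥0∞) ≠ ∞ := fun φ => by
    simp only [hcoe]
    exact (lintegral_rpow_enorm_lt_top_of_eLpNorm_lt_top hp₀0 hp₀' (Lp.eLpNorm_lt_top φ)).ne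
  have hmain := hA _ _ _ ((Lp.stronglyMeasurable (T (hf.toLpVec p₀))).measurable.nnnorm.pow_const a)
    ((Lp.stronglyMeasurable (hf.toLpVec p₀)).measurable.nnnorm.pow_const a)
    ((Lp.stronglyMeasurable (S (lpAbs (hf.toLpVec p)))).measurable.nnnorm.pow_const a)
    (hfin _) (hfin _) (hdec f hf)
  simp only [hcoe'] at hmain
  have hv : ∫⁻ y, ‖hf.toLpVec p₀ y‖ₑ ^ b = ∫⁻ y, ‖f y‖ₑ ^ b := by
    refine lintegral_congr_ae ?_
    filter_upwards [(hf.memLp p₀).coeFn_toLp] with y hy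
    have e : hf.toLpVec p₀ y = f y := hy
    rw [e]
  have hS : ∫⁻ y, ‖S (lpAbs (hf.toLpVec p)) y‖ₑ ^ b ≤ (Bs : ℝ≥0∞) ^ b * ∫⁻ y, ‖f y‖ₑ ^ b := by
    refine lintegral_rpow_enorm_le_of_eLpNorm_le hp0 hp' ((hBs _).trans ?_)
    gcongr
    refine (eLpNorm_mono_ae (g := f) ?_)
    filter_upwards [coeFn_lpAbs (hf.toLpVec p), (hf.memLp p).coeFn_toLp] with y hy hy'
    have e : hf.toLpVec p y = f y := hy'
    rw [hy, e, EuclideanSpace.norm_eq, EuclideanSpace.norm_eq]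
    simp [vecAbs]
  rw [hv] at hmain
  rw [eLpNorm_eq_lintegral_rpow_enorm_toReal hp0 hp',
    eLpNorm_eq_lintegral_rpow_enorm_toReal hp0 hp', ← hb_def]
  set I := ∫⁻ y, ‖f y‖ₑ ^ b
  have hb1 : 0 ≤ 1 / b := by positivity
  calc (∫⁻ y, ‖T (hf.toLpVec p₀) y‖ₑ ^ b) ^ (1 / b)
      ≤ ((A * (1 + Bs ^ b) : ℝ≥0) * I) ^ (1 / b) := by
        gcongr
        refine hmain.trans ?_
        rw [ENNReal.coe_mul, mul_assoc]
        gcongr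
        push_cast
        rw [ENNReal.coe_rpow_of_nonneg _ hb0.le, add_mul, one_mul]
        gcongr
    _ = ((A * (1 + Bs ^ b)) ^ (1 / b) : ℝ≥0) * I ^ (1 / b) := by
        rw [ENNReal.mul_rpow_of_nonneg _ _ hb1, ENNReal.coe_rpow_of_nonneg _ hb1]
    _ ≤ _ := by
        gcongr
        rw [← ENNReal.ofReal_coe_nnreal]
        exact ENNReal.ofReal_le_ofReal (by linarith)

end Main

theorem mainTheorem7 (d m : ℕ) (p₀ q₀ p : ℝ≥0∞) (hp₀ : 1 ≤ p₀) (hp₀p : p₀ < p) (hpq₀ : p < q₀)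
    (T : LpVec d m p₀ → LpVec d m p₀) (hTsub : IsSublinearOnLp T) (hTbdd : IsBoundedOnLp T)
    (S : LpVec d m p →ₗ[ℝ] LpVec d m p) (hSmono : IsAbsMonotone S) (hSbdd : IsBoundedOnLp S)
    (α₁ α₂ C : ℝ) (hα₁ : 1 < α₁) (hα₂ : α₁ < α₂) (hC : 0 < C)
    (hTS : ∀ (c : EuclideanSpace ℝ (Fin d)) (r : ℝ), 0 < r →
      ∀ (f : EuclideanSpace ℝ (Fin d) → EuclideanSpace ℝ (Fin m)) (hf : IsLinftyC f),
        tsupport f ⊆ (cube c (α₂ * r))ᶜ →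
        ∀ᵐ x ∂(volume.restrict (cube c r)),
          lpAverage q₀ (cube c r) (T (hf.toLpVec p₀)) ≤
            ENNReal.ofReal C *
              (lpAverage p₀ (cube c (α₁ * r)) (T (hf.toLpVec p₀)) +
                ‖S (lpAbs (hf.toLpVec p)) x‖ₑ)) :
    ∃ K : ℝ, 0 < K ∧
      ∀ (f : EuclideanSpace ℝ (Fin d) → EuclideanSpace ℝ (Fin m)) (hf : IsLinftyC f),
        eLpNorm (T (hf.toLpVec p₀)) p volume ≤ ENNReal.ofReal K * eLpNorm f p volume := by
  have hp₀0 : p₀ ≠ 0 := (one_pos.trans_le hp₀).ne'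
  have hp0 : p ≠ 0 := (zero_le.trans_lt hp₀p).ne'
  rcases eq_or_ne d 0 with rfl | hd
  · obtain ⟨B, hB⟩ := hTbdd.exists_eLpNorm_le
    refine ⟨B + 1, by positivity, fun f hf => ?_⟩
    rw [eLpNorm_eq_eLpNorm_of_isEmpty _ hp0 hp₀0, eLpNorm_eq_eLpNorm_of_isEmpty f hp0 hp₀0,
      ← eLpNorm_congr_ae (hf.memLp p₀).coeFn_toLp]
    refine (hB _).trans ?_
    gcongr ?_ * _
    rw [← ENNReal.ofReal_coe_nnreal]
    exact ENNReal.ofReal_le_ofReal (by linarith)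
  · have : NeZero d := ⟨hd⟩
    -- An infinite exponent `q₀` may be lowered to a finite one, by monotonicity of the averages.
    obtain ⟨q, hpq, hqq₀⟩ := exists_between hpq₀
    refine exists_eLpNorm_le_of_reverse_holder hp₀ hp₀p hpq hqq₀.ne_top hTsub hTbdd hSmono hSbdd
      hα₁ hα₂ (C := C) fun c r hr f hf hsupp => ?_
    filter_upwards [hTS c r hr f hf hsupp] with x hx
    exact (lpAverage_mono_exponent hqq₀.le (volume_cube_ne_zero c hr) (volume_cube_ne_top c hr.le)
      (Lp.aestronglyMeasurable _)).trans hx
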